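/- **Setting.** An *instance with parameter $m$* is a nonempty set $A\subseteq[2^{-m},2^m]^2$ such that, for every $\lambda\in[0,\infty]$, the function $h_\lambda(x,y)=y+\lambda x$ (with $h_\infty(x,y)=x$) attains its minimum over $A$. An *exact Comb routine* returns, for every instance $A$ and every $\lambda\in[0,\infty]$, a point $\mathrm{Comb}(\lambda)\in A$ minimizing $h_\lambda$ over $A$; ties are broken arbitrarily. For $\varepsilon>0$, an *$\varepsilon$-convex Pareto set* of $A$ is a subset $S\subseteq A$ such that every $p\in A$ satisfies $q\le(1+\varepsilon)p$ coordinatewise for some $q$ in the convex hull of $S$; $\mathrm{OPT}_\varepsilon(A)$ is the smallest cardinality of such a set. The ratio distance from a point $p$ to a point $q$ is $\mathcal{RD}(p,q)=\max\{x(q)/x(p)-1,\;y(q)/y(p)-1,\;0\}$, and for a segment $lr$ we put $\mathcal{RD}(p,lr)=\inf_{q\in lr}\mathcal{RD}(p,q)$. The *Chord algorithm* (for the ratio distance, with accuracy $\varepsilon$) computes $a=\mathrm{Comb}(\infty)$, $b=\mathrm{Comb}(0)$, $c=(x(a),y(b))$ and returns $\mathrm{Chord}(\{a,b,c\})$. The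 recursive routine $\mathrm{Chord}(\{l,r,s\})$ is as follows. If $\mathcal{RD}(s,lr)\le\varepsilon$, return $\{l,r\}$. Otherwise let $\lambda$ be the absolute slope of $lr$ and $q=\mathrm{Comb}(\lambda)$; if $\mathcal{RD}(q,lr)\le\varepsilon$, return $\{l,r\}$. Otherwise let $s_l,s_r$ be the points in which the line through $q$ parallel to $lr$ meets the segments $ls$ and $rs$, and return $\mathrm{Chord}(\{l,q,s_l\})\cup\mathrm{Chord}(\{q,r,s_r\})$. Let $\mathrm{CHORD}_\varepsilon(A)$ be the total number of calls to Comb (infinite if the algorithm does not halt). The *worst-case performance ratio* is $$\rho(m,\varepsilon)=\sup_A\frac{\mathrm{CHORD}_\varepsilon(A)}{\mathrm{OPT}_\varepsilon(A)},$$ the supremum being over all instances $A$ with parameter $m$. **Theorem.** The worst-case performance ratio of the Chord algorithm with respect to the ratio distance is $\Theta\!\left(\frac{m+\log(1/\varepsilon)}{\log m+\log\log(1/\varepsilon)}\right)$. Precisely, with logarithms to base $2$, there are absolute constants $c,C>0$ and $0<\varepsilon_0\le\frac12$ such that, for every exact Comb routine and every real $m\ge1$: 1. $\displaystyle \rho(m,\varepsilon)\le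 C\cdot\frac{m+\log(1/\varepsilon)}{\log m+\log\log(1/\varepsilon)}$ for all $0<\varepsilon<\tfrac12$; 2. $\displaystyle \rho(m,\varepsilon)\ge c\cdot\frac{m+\log(1/\varepsilon)}{\log m+\log\log(1/\varepsilon)}$ for all $0<\varepsilon<\varepsilon_0$. -/

import Mathlib

open scoped ENNReal

noncomputable section

namespace ChordAlg

/-- The combined objective `h_lam(x, y) = y + lam * x` for a slope `lam ∈ [0, ∞]`; for `lam = ∞`
it is, by convention, the objective `x`. -/
def combObj (lam : ℝ≥0∞) (p : ℝ × ℝ) : ℝ :=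
  if lam = ∞ then p.1 else p.2 + lam.toReal * p.1

/-- The objective space of an instance with parameter `m`: a nonempty set of points with both
coordinates in `[2^(-m), 2^m]` (finite or infinite, convex or not), on which every linear
optimization problem `min h_lam`, `lam ∈ [0, ∞]`, has an optimal solution. -/
structure IsInstance (m : ℝ) (A : Set (ℝ × ℝ)) : Prop where
  nonempty : A.Nonempty
  bounded : ∀ p ∈ A, p.1 ∈ Set.Icc ((2 : ℝ) ^ (-m)) ((2 : ℝ) ^ m) ∧
    p.2 ∈ Set.Icc ((2 : ℝ) ^ (-m)) ((2 : ℝ) ^ m)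
  exists_min : ∀ lam : ℝ≥0∞, ∃ q ∈ A, IsMinOn (combObj lam) A q

/-- An exact `Comb` routine: on the objective space `A` and the slope `lam` it returns a point of
`A` that minimizes `h_lam` over `A` (if there is one). Ties are broken in an arbitrary way. -/
def IsExactComb (Comb : Set (ℝ × ℝ) → ℝ≥0∞ → ℝ × ℝ) : Prop :=
  ∀ (A : Set (ℝ × ℝ)) (lam : ℝ≥0∞), (∃ q ∈ A, IsMinOn (combObj lam) A q) →
    Comb A lam ∈ A ∧ IsMinOn (combObj lam) A (Comb A lam)

/-- `q` `ε`-covers `p` : `q ≤ (1 + ε) p` coordinatewise. -/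
def EpsCovers (ε : ℝ) (q p : ℝ × ℝ) : Prop :=
  q.1 ≤ (1 + ε) * p.1 ∧ q.2 ≤ (1 + ε) * p.2

/-- `S` is an `ε`-convex Pareto set of `A`: a subset of `A` whose convex combinations `ε`-cover
every point of `A`. -/
def IsEpsCP (ε : ℝ) (A S : Set (ℝ × ℝ)) : Prop :=
  S ⊆ A ∧ ∀ p ∈ A, ∃ q ∈ convexHull ℝ S, EpsCovers ε q p

/-- The size of a smallest `ε`-convex Pareto set of `A`. -/
def opt (ε : ℝ) (A : Set (ℝ × ℝ)) : ℕ∞ :=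
  ⨅ S ∈ {S : Set (ℝ × ℝ) | IsEpsCP ε A S}, S.encard

/-- The ratio distance from the point `p` to the point `q`. -/
def ratioDist (p q : ℝ × ℝ) : ℝ :=
  max (max (q.1 / p.1 - 1) (q.2 / p.2 - 1)) 0

/-- The ratio distance from the point `p` to the segment with endpoints `l` and `r`. -/
def ratioDistSeg (p l r : ℝ × ℝ) : ℝ :=
  sInf (ratioDist p '' segment ℝ l r)

/-- The absolute slope of the line through `l` and `r`. The algorithm uses it only if the two
points differ in both coordinates. -/
def absSlope (l r : ℝ × ℝ) : ℝ≥0∞ :=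
  ENNReal.ofReal |(r.2 - l.2) / (r.1 - l.1)|

/-- `ChordRoutine comb ε l r s Q n`: the recursive routine, called with the oracle `comb`, the
accuracy `ε` and the ordered triple `{l, r, s}`, halts, returns the set `Q`, and makes exactly `n`
calls to `comb`, the calls made in the recursion included. -/
inductive ChordRoutine (comb : ℝ≥0∞ → ℝ × ℝ) (ε : ℝ) :
    ℝ × ℝ → ℝ × ℝ → ℝ × ℝ → Set (ℝ × ℝ) → ℕ → Prop
  /-- `RD(s, lr) ≤ ε`: return without a call. -/
  | covered (l r s : ℝ × ℝ) (hs : ratioDistSeg s l r ≤ ε) :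
      ChordRoutine comb ε l r s {l, r} 0
  /-- One call gives `q`, and `RD(q, lr) ≤ ε`. -/
  | leaf (l r s : ℝ × ℝ) (hs : ε < ratioDistSeg s l r)
      (hq : ratioDistSeg (comb (absSlope l r)) l r ≤ ε) :
      ChordRoutine comb ε l r s {l, r} 1
  /-- One call gives `q`, and `RD(q, lr) > ε`. The line through `q` parallel to `lr` meets the
  segments `ls` and `rs` in `sl` and `sr`; recurse on `{l, q, sl}` and `{q, r, sr}`. -/
  | split (l r s q sl sr : ℝ × ℝ) (Ql Qr : Set (ℝ × ℝ)) (nl nr : ℕ)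
      (hs : ε < ratioDistSeg s l r)
      (hcomb : q = comb (absSlope l r))
      (hq : ε < ratioDistSeg q l r)
      (hsl : sl ∈ segment ℝ l s ∧ combObj (absSlope l r) sl = combObj (absSlope l r) q)
      (hsr : sr ∈ segment ℝ r s ∧ combObj (absSlope l r) sr = combObj (absSlope l r) q)
      (hl : ChordRoutine comb ε l q sl Ql nl)
      (hr : ChordRoutine comb ε q r sr Qr nr) :
      ChordRoutine comb ε l r s (Ql ∪ Qr) (1 + nl + nr)

/-- `ChordAlgorithm comb ε Q n`: the Chord algorithm halts, returns `Q`, and makes exactly `n`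
calls to `comb`: the calls `a = comb ∞` and `b = comb 0`, and those of the routine on
`{a, b, c}` with `c = (x(a), y(b))`. -/
def ChordAlgorithm (comb : ℝ≥0∞ → ℝ × ℝ) (ε : ℝ) (Q : Set (ℝ × ℝ)) (n : ℕ) : Prop :=
  ∃ k : ℕ, ChordRoutine comb ε (comb ∞) (comb 0) ((comb ∞).1, (comb 0).2) Q k ∧ n = k + 2

/-- The number of calls to `comb` made by the Chord algorithm (`⊤` if it does not halt). -/
def chordCalls (comb : ℝ≥0∞ → ℝ × ℝ) (ε : ℝ) : ℕ∞ :=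
  ⨅ n ∈ {n : ℕ | ∃ Q, ChordAlgorithm comb ε Q n}, (n : ℕ∞)

/-- The worst-case performance ratio of the Chord algorithm with accuracy `ε` and the routine
`Comb`: the supremum, over all instances with values in `[2^(-m), 2^m]`, of the number of calls
divided by the size of a smallest `ε`-convex Pareto set. -/
def worstCaseRatio (Comb : Set (ℝ × ℝ) → ℝ≥0∞ → ℝ × ℝ) (m ε : ℝ) : ℝ≥0∞ :=
  ⨆ A ∈ {A : Set (ℝ × ℝ) | IsInstance m A},
    (chordCalls (Comb A) ε : ℝ≥0∞) / (opt ε A : ℝ≥0∞)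

/-- The rate `(m + log (1/ε)) / (log m + log log (1/ε))`, with logarithms to base two. -/
def chordRate (m ε : ℝ) : ℝ :=
  (m + Real.logb 2 (1 / ε)) / (Real.logb 2 m + Real.logb 2 (Real.logb 2 (1 / ε)))

end ChordAlg

end

/-! Upper bound. Fix a smallest ε-convex Pareto set `S`, which may be assumed finite. To each
triangle of the recursion attach its content: the points of `S` strictly below `lr`. A triangle that
splits has nonempty content, since `S` must cover `q`, and its children have disjoint contents
inside its own (`IsSplit.content_nonempty`, `IsSplit.disjoint_content`). So the splits fall into at
most 2|S| - 1 chains of constant content, and it remains to bound the length of one chain.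

Let L = m + log(1/ε), and write q = αl + βs + γr. The child that drops `r` keeps the fraction βγ of
the area. Areas of split triangles are bounded above and below, so only O(L / log(1/θ)) steps of a
chain have a factor below θ. In all other steps both weights are at least θ. For these, follow the
objective whose level line was `lr` when an endpoint was first replaced, and let M be its value at
the new point. The hull of `S` reaches the value (1 + ε)M, but the content stays in the current
triangle, so the value at the moving endpoint can rise by at most εM (`IsFan.rise_le_one`). Since
`q` is not ε-covered, about every second such step forces a rise of θ³εM (`IsFan.near`,
`Progress.near`). With θ = L^(-1/6) this allows O(√L) such steps against O(L / log L) steps of small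
area factor.

Lower bound. On a staircase whose points approach a vertical line geometrically with ratio K and
rise by at most ε in all, two points suffice, but Chord finds the points one by one. About N steps
fit if K^N is at most of order 2^m/ε; taking K of order N gives N of order L / log L
(`le_chordCalls_stair`, `opt_stairSet_le`). -/

namespace ChordAlg

/-! ### Linear objectives and the ratio distance -/

/-- The height of `w` above the line through `a` and `b`, scaled by `b.1 - a.1`. -/
def lineHt (a b w : ℝ × ℝ) : ℝ := (a.2 - b.2) * (w.1 - a.1) + (b.1 - a.1) * (w.2 - a.2)

/-- The linear objective with coefficients `a` and `c`. -/
def linObj (a c : ℝ) (w : ℝ × ℝ) : ℝ := a * w.1 + c * w.2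

lemma lineHt_eq_linObj (a b w : ℝ × ℝ) :
    lineHt a b w = linObj (a.2 - b.2) (b.1 - a.1) w - linObj (a.2 - b.2) (b.1 - a.1) a := by
  simp only [lineHt, linObj]; ring

lemma linObj_le_of_epsCovers {a c ε : ℝ} {z q : ℝ × ℝ} (ha : 0 ≤ a) (hc : 0 ≤ c)
    (h : EpsCovers ε z q) : linObj a c z ≤ (1 + ε) * linObj a c q := by
  have h₁ := mul_le_mul_of_nonneg_left h.1 ha
  have h₂ := mul_le_mul_of_nonneg_left h.2 hc
  simp only [linObj]; linarith

lemma le_linObj_of_mem_convexHull {a c v : ℝ} {S : Set (ℝ × ℝ)} (h : ∀ w ∈ S, v ≤ linObj a c w)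
    {z : ℝ × ℝ} (hz : z ∈ convexHull ℝ S) : v ≤ linObj a c z := by
  have hconv : Convex ℝ {w : ℝ × ℝ | v ≤ linObj a c w} := by
    intro x hx y hy s t hs ht hst
    simp only [Set.mem_ofPred_eq, linObj, Prod.fst_add, Prod.snd_add, Prod.smul_fst, Prod.smul_snd,
      smul_eq_mul] at *
    have h₁ := mul_le_mul_of_nonneg_left hx hs
    have h₂ := mul_le_mul_of_nonneg_left hy ht
    have h₃ : v = s * v + t * v := by rw [← add_mul, hst, one_mul]
    linarith
  exact convexHull_min (fun w hw => h w hw) hconv hz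

lemma ratioDist_nonneg (p q : ℝ × ℝ) : 0 ≤ ratioDist p q := le_max_right _ _

lemma ratioDistSeg_le {ε : ℝ} {p l r z : ℝ × ℝ} (hε : 0 ≤ ε) (h₁ : 0 < p.1) (h₂ : 0 < p.2)
    (hz : z ∈ segment ℝ l r) (h : EpsCovers ε z p) : ratioDistSeg p l r ≤ ε := by
  have hd : ratioDist p z ≤ ε := by
    refine max_le (max_le ?_ ?_) hε
    · rw [sub_le_iff_le_add, div_le_iff₀ h₁]; linarith [h.1]
    · rw [sub_le_iff_le_add, div_le_iff₀ h₂]; linarith [h.2]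
  refine le_trans (csInf_le ⟨0, ?_⟩ (Set.mem_image_of_mem _ hz)) hd
  rintro _ ⟨w, -, rfl⟩
  exact ratioDist_nonneg _ _

lemma epsCovers_ratioDist {p z : ℝ × ℝ} (h₁ : 0 < p.1) (h₂ : 0 < p.2) :
    EpsCovers (ratioDist p z) z p := by
  have a₁ : z.1 / p.1 - 1 ≤ ratioDist p z := (le_max_left _ _).trans (le_max_left _ _)
  have a₂ : z.2 / p.2 - 1 ≤ ratioDist p z := (le_max_right _ _).trans (le_max_left _ _)
  rw [sub_le_iff_le_add, div_le_iff₀ h₁] at a₁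
  rw [sub_le_iff_le_add, div_le_iff₀ h₂] at a₂
  exact ⟨by linarith, by linarith⟩

/-- Separation: a point at ratio distance δ from `p` has objective at most 1 + δ times that of `p`,
while every point of the segment has objective at least `v`. -/
lemma lt_ratioDistSeg {a c ε v : ℝ} {p l r : ℝ × ℝ} (h₁ : 0 < p.1) (h₂ : 0 < p.2)
    (ha : 0 ≤ a) (hc : 0 < c) (hl : v ≤ linObj a c l) (hr : v ≤ linObj a c r)
    (h : (1 + ε) * linObj a c p < v) : ε < ratioDistSeg p l r := by
  have hp : 0 < linObj a c p := by unfold linObj; positivity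
  have hlt : ε < v / linObj a c p - 1 := by
    rw [lt_sub_iff_add_lt, lt_div_iff₀ hp]; linarith
  refine hlt.trans_le (le_csInf ((Set.image_nonempty).2 ⟨l, left_mem_segment ℝ l r⟩) ?_)
  rintro _ ⟨z, hz, rfl⟩
  have hvz : v ≤ linObj a c z := by
    refine le_linObj_of_mem_convexHull (S := {l, r}) ?_ (by rwa [convexHull_pair])
    rintro w (rfl | rfl) <;> assumption
  have := linObj_le_of_epsCovers ha hc.le (epsCovers_ratioDist (z := z) h₁ h₂)
  rw [sub_le_iff_le_add, div_le_iff₀ hp]; linarith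

/-- A point that the segment `lr` does not `ε`-cover lies strictly below it, even after scaling
by `1 + ε`. -/
lemma below_of_lt_ratioDistSeg {ε : ℝ} {p l r : ℝ × ℝ} (hε : 0 ≤ ε) (h₁ : 0 < p.1) (h₂ : 0 < p.2)
    (hl : l.1 ≤ p.1) (hr : r.2 ≤ p.2) (h : ε < ratioDistSeg p l r) :
    (1 + ε) * p.1 < r.1 ∧ (1 + ε) * p.2 < l.2 ∧
      ∃ τ : ℝ, 0 ≤ τ ∧ τ ≤ 1 ∧ (1 + ε) * p.1 = l.1 + τ * (r.1 - l.1) ∧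
        (1 + ε) * p.2 < l.2 + τ * (r.2 - l.2) := by
  have key : ∀ z ∈ segment ℝ l r, ¬ EpsCovers ε z p := fun z hz hc =>
    (ratioDistSeg_le hε h₁ h₂ hz hc).not_gt h
  have e₁ : p.1 ≤ (1 + ε) * p.1 := by nlinarith
  have e₂ : p.2 ≤ (1 + ε) * p.2 := by nlinarith
  have hrx : (1 + ε) * p.1 < r.1 := by
    by_contra! hc
    exact key r (right_mem_segment ℝ l r) ⟨hc, hr.trans e₂⟩
  have hly : (1 + ε) * p.2 < l.2 := by
    by_contra! hc
    exact key l (left_mem_segment ℝ l r) ⟨hl.trans e₁, hc⟩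
  have hlr : 0 < r.1 - l.1 := by linarith
  refine ⟨hrx, hly, ((1 + ε) * p.1 - l.1) / (r.1 - l.1), ?_, ?_, ?_, ?_⟩
  · exact div_nonneg (by linarith) hlr.le
  · rw [div_le_one hlr]; linarith
  · field_simp; ring
  · set τ := ((1 + ε) * p.1 - l.1) / (r.1 - l.1) with hτ
    have hτ₀ : 0 ≤ τ := div_nonneg (by linarith) hlr.le
    have hτ₁ : τ ≤ 1 := by rw [hτ, div_le_one hlr]; linarith
    by_contra! hc
    refine key ((1 - τ) • l + τ • r) ⟨1 - τ, τ, by linarith, hτ₀, by ring, rfl⟩ ⟨?_, ?_⟩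
    · have : τ * (r.1 - l.1) = (1 + ε) * p.1 - l.1 := div_mul_cancel₀ _ hlr.ne'
      simp only [Prod.fst_add, Prod.smul_fst, smul_eq_mul]; linarith
    · simp only [Prod.snd_add, Prod.smul_snd, smul_eq_mul]; linarith

/-! ### Triangles of the recursion and their splits -/

/-- The invariant of the triangles `{l, r, s}` of the recursion on the objective space `A`. -/
structure IsFrame (A : Set (ℝ × ℝ)) (l r s : ℝ × ℝ) : Prop where
  left_mem : l ∈ A
  right_mem : r ∈ A
  left_x : l.1 ≤ s.1
  right_x : s.1 ≤ r.1
  right_y : r.2 ≤ s.2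
  left_y : s.2 ≤ l.2
  above_left : ∀ w ∈ A, 0 ≤ lineHt l s w
  above_right : ∀ w ∈ A, 0 ≤ lineHt s r w

lemma lineHt_add_lineHt (l r s w : ℝ × ℝ) :
    lineHt l s w + lineHt s r w = lineHt l r w - lineHt l r s := by
  simp only [lineHt]; ring

lemma IsFrame.apex_le {A : Set (ℝ × ℝ)} {l r s w : ℝ × ℝ} (h : IsFrame A l r s) (hw : w ∈ A) :
    lineHt l r s ≤ lineHt l r w := by
  linarith [h.above_left w hw, h.above_right w hw, lineHt_add_lineHt l r s w]

/-- `q` is the convex combination of `l`, `s` and `r` with weights `α`, `β` and `γ`. -/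
structure IsBary (l s r q : ℝ × ℝ) (α β γ : ℝ) : Prop where
  nonneg₁ : 0 ≤ α
  nonneg₂ : 0 ≤ β
  nonneg₃ : 0 ≤ γ
  sum_eq : α + β + γ = 1
  fst_eq : q.1 = α * l.1 + β * s.1 + γ * r.1
  snd_eq : q.2 = α * l.2 + β * s.2 + γ * r.2

lemma IsBary.symm {l s r q : ℝ × ℝ} {α β γ : ℝ} (h : IsBary l s r q α β γ) :
    IsBary r s l q γ β α :=
  ⟨h.nonneg₃, h.nonneg₂, h.nonneg₁, by linarith [h.sum_eq], by linarith [h.fst_eq],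
    by linarith [h.snd_eq]⟩

lemma IsBary.linObj_eq {l s r q : ℝ × ℝ} {α β γ : ℝ} (h : IsBary l s r q α β γ) (a c : ℝ) :
    linObj a c q = α * linObj a c l + β * linObj a c s + γ * linObj a c r := by
  simp only [linObj, h.fst_eq, h.snd_eq]; ring

lemma IsBary.le_linObj {l s r q : ℝ × ℝ} {α β γ a c v : ℝ} (h : IsBary l s r q α β γ)
    (hl : v ≤ linObj a c l) (hs : v ≤ linObj a c s) (hr : v ≤ linObj a c r) :
    v ≤ linObj a c q := by
  have h₁ := mul_le_mul_of_nonneg_left hl h.nonneg₁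
  have h₂ := mul_le_mul_of_nonneg_left hs h.nonneg₂
  have h₃ := mul_le_mul_of_nonneg_left hr h.nonneg₃
  have h₄ : v = α * v + β * v + γ * v := by rw [← add_mul, ← add_mul, h.sum_eq, one_mul]
  rw [h.linObj_eq]; linarith

/-- The weights are ratios of heights over the three sides; the frame and `hlw` give their signs. -/
lemma IsFrame.exists_isBary {A : Set (ℝ × ℝ)} {l r s w : ℝ × ℝ} (h : IsFrame A l r s)
    (hw : w ∈ A) (hs : lineHt l r s < 0) (hlw : lineHt l r w ≤ 0) :
    ∃ α β γ : ℝ, IsBary l s r w α β γ ∧ β * lineHt l r s = lineHt l r w := by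
  have hD : lineHt l r s ≠ 0 := hs.ne
  refine ⟨lineHt s r w / (-lineHt l r s), lineHt l r w / lineHt l r s,
    lineHt l s w / (-lineHt l r s), ⟨?_, ?_, ?_, ?_, ?_, ?_⟩, ?_⟩
  · exact div_nonneg (h.above_right w hw) (by linarith)
  · exact div_nonneg_of_nonpos hlw hs.le
  · exact div_nonneg (h.above_left w hw) (by linarith)
  · have := lineHt_add_lineHt l r s w
    field_simp; linarith
  · field_simp; simp only [lineHt]; ring
  · field_simp; simp only [lineHt]; ring
  · field_simp

lemma combObj_absSlope {l r : ℝ × ℝ} (hx : l.1 < r.1) (hy : r.2 < l.2) (w : ℝ × ℝ) :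
    (r.1 - l.1) * combObj (absSlope l r) w = linObj (l.2 - r.2) (r.1 - l.1) w := by
  have hx' : 0 < r.1 - l.1 := by linarith
  have habs : |(r.2 - l.2) / (r.1 - l.1)| = (l.2 - r.2) / (r.1 - l.1) := by
    rw [abs_div, abs_of_pos hx', abs_of_neg (by linarith)]; ring
  have hfin : absSlope l r ≠ ∞ := ENNReal.ofReal_ne_top
  rw [combObj, if_neg hfin, absSlope, ENNReal.toReal_ofReal (abs_nonneg _), habs, linObj]
  field_simp; ring

lemma lineHt_le_iff_combObj {l r : ℝ × ℝ} (hx : l.1 < r.1) (hy : r.2 < l.2) (v w : ℝ × ℝ) :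
    lineHt l r v ≤ lineHt l r w ↔ combObj (absSlope l r) v ≤ combObj (absSlope l r) w := by
  have hx' : 0 < r.1 - l.1 := by linarith
  rw [lineHt_eq_linObj, lineHt_eq_linObj, ← combObj_absSlope hx hy v,
    ← combObj_absSlope hx hy w,
    sub_le_sub_iff_right, mul_le_mul_iff_right₀ hx']

lemma lineHt_eq_iff_combObj {l r : ℝ × ℝ} (hx : l.1 < r.1) (hy : r.2 < l.2) (v w : ℝ × ℝ) :
    lineHt l r v = lineHt l r w ↔ combObj (absSlope l r) v = combObj (absSlope l r) w := by
  simp only [le_antisymm_iff, lineHt_le_iff_combObj hx hy]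

/-- The data of a recursive step that splits the triangle `{l, r, s}` at `q`. -/
structure IsSplit (A : Set (ℝ × ℝ)) (ε : ℝ) (l r s q : ℝ × ℝ) (α β γ : ℝ) : Prop where
  mem : q ∈ A
  lt_x : l.1 < r.1
  lt_y : r.2 < l.2
  apex : lineHt l r s < 0
  isBary : IsBary l s r q α β γ
  pos : 0 < β
  isMin : ∀ w ∈ A, lineHt l r q ≤ lineHt l r w
  right_x : (1 + ε) * q.1 < r.1
  below : ∃ τ : ℝ, 0 ≤ τ ∧ τ ≤ 1 ∧ (1 + ε) * q.1 = l.1 + τ * (r.1 - l.1) ∧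
    (1 + ε) * q.2 < l.2 + τ * (r.2 - l.2)

lemma IsFrame.below_apex {A : Set (ℝ × ℝ)} {ε : ℝ} {l r s : ℝ × ℝ} (h : IsFrame A l r s)
    (hε : 0 ≤ ε) (hA : ∀ p ∈ A, 0 < p.1 ∧ 0 < p.2) (hs : ε < ratioDistSeg s l r) :
    l.1 < r.1 ∧ r.2 < l.2 ∧ lineHt l r s < 0 := by
  have s₁ : 0 < s.1 := (hA l h.left_mem).1.trans_le h.left_x
  have s₂ : 0 < s.2 := (hA r h.right_mem).2.trans_le h.right_y
  obtain ⟨h₁, h₂, τ, -, -, h₃, h₄⟩ := below_of_lt_ratioDistSeg hε s₁ s₂ h.left_x h.right_y hs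
  have e₁ : s.1 ≤ (1 + ε) * s.1 := by nlinarith
  have e₂ : s.2 ≤ (1 + ε) * s.2 := by nlinarith
  have hx : l.1 < r.1 := by linarith [h.left_x]
  have hy : r.2 < l.2 := by linarith [h.right_y]
  refine ⟨hx, hy, ?_⟩
  have a₁ : (l.2 - r.2) * (s.1 - l.1) ≤ (l.2 - r.2) * (τ * (r.1 - l.1)) :=
    mul_le_mul_of_nonneg_left (by linarith) (by linarith)
  have a₂ : (r.1 - l.1) * (s.2 - l.2) < (r.1 - l.1) * (τ * (r.2 - l.2)) :=
    mul_lt_mul_of_pos_left (by linarith) (by linarith)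
  simp only [lineHt]; linarith

lemma IsFrame.exists_isSplit {A : Set (ℝ × ℝ)} {ε : ℝ} {l r s q : ℝ × ℝ} (h : IsFrame A l r s)
    (hε : 0 ≤ ε) (hA : ∀ p ∈ A, 0 < p.1 ∧ 0 < p.2) (hs : ε < ratioDistSeg s l r)
    (hq : q ∈ A) (hmin : IsMinOn (combObj (absSlope l r)) A q) (hqs : ε < ratioDistSeg q l r) :
    ∃ α β γ : ℝ, IsSplit A ε l r s q α β γ := by
  obtain ⟨hx, hy, hapex⟩ := h.below_apex hε hA hs
  have hm : ∀ w ∈ A, lineHt l r q ≤ lineHt l r w := fun w hw =>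
    (lineHt_le_iff_combObj hx hy q w).2 (hmin hw)
  have hle : lineHt l r q ≤ 0 := (hm l h.left_mem).trans (by simp [lineHt])
  obtain ⟨α, β, γ, hb, hβ⟩ := h.exists_isBary hq hapex hle
  have hlq : l.1 ≤ q.1 := by
    simpa [linObj] using hb.le_linObj (a := 1) (c := 0) (v := l.1) (by simp [linObj])
      (by simpa [linObj] using h.left_x) (by simpa [linObj] using hx.le)
  have hrq : r.2 ≤ q.2 := by
    simpa [linObj] using hb.le_linObj (a := 0) (c := 1) (v := r.2)
      (by simpa [linObj] using hy.le) (by simpa [linObj] using h.right_y) (by simp [linObj])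
  obtain ⟨h₁, h₂, hτ⟩ := below_of_lt_ratioDistSeg hε (hA q hq).1 (hA q hq).2 hlq hrq hqs
  refine ⟨α, β, γ, hq, hx, hy, hapex, hb, ?_, hm, h₁, hτ⟩
  -- With β = 0 the point `q` would lie on the line `lr`, but even `(1 + ε) q` is strictly below it.
  rcases hb.nonneg₂.lt_or_eq with h' | h'
  · exact h'
  exfalso
  obtain ⟨τ, -, -, h₃, h₄⟩ := hτ
  have a₁ : (l.2 - r.2) * (q.1 - l.1) ≤ (l.2 - r.2) * (τ * (r.1 - l.1)) :=
    mul_le_mul_of_nonneg_left (by nlinarith [(hA q hq).1]) (by linarith)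
  have a₂ : (r.1 - l.1) * (q.2 - l.2) < (r.1 - l.1) * (τ * (r.2 - l.2)) :=
    mul_lt_mul_of_pos_left (by nlinarith [(hA q hq).2]) (by linarith)
  rw [← h', zero_mul] at hβ
  simp only [lineHt] at hβ; linarith

lemma IsSplit.left_x {A : Set (ℝ × ℝ)} {ε : ℝ} {l r s q : ℝ × ℝ} {α β γ : ℝ}
    (h : IsSplit A ε l r s q α β γ) (hf : IsFrame A l r s) : l.1 ≤ q.1 := by
  simpa [linObj] using h.isBary.le_linObj (a := 1) (c := 0) (v := l.1) (by simp [linObj])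
    (by simpa [linObj] using hf.left_x) (by simpa [linObj] using h.lt_x.le)

/-- After scaling by `1 + ε` the new point is still below the line `lr`, so no monotone linear
objective exceeds its larger value at the two endpoints. -/
lemma IsSplit.linObj_le_max {A : Set (ℝ × ℝ)} {ε : ℝ} {l r s q : ℝ × ℝ} {α β γ : ℝ}
    (h : IsSplit A ε l r s q α β γ) {a c : ℝ} (hc : 0 ≤ c) :
    (1 + ε) * linObj a c q ≤ max (linObj a c l) (linObj a c r) := by
  obtain ⟨τ, h₀, h₁, h₂, h₃⟩ := h.below
  have e₁ := mul_le_mul_of_nonneg_left h₃.le hc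
  have e₂ := mul_le_mul_of_nonneg_left (le_max_left (linObj a c l) (linObj a c r)) (sub_nonneg.2 h₁)
  have e₃ := mul_le_mul_of_nonneg_left (le_max_right (linObj a c l) (linObj a c r)) h₀
  have e₄ : a * ((1 + ε) * q.1) = a * (l.1 + τ * (r.1 - l.1)) := by rw [h₂]
  simp only [linObj] at *
  linarith

lemma IsSplit.linObj_lt {A : Set (ℝ × ℝ)} {ε : ℝ} {l r s q : ℝ × ℝ} {α β γ : ℝ}
    (h : IsSplit A ε l r s q α β γ) :
    (1 + ε) * linObj (l.2 - r.2) (r.1 - l.1) q < linObj (l.2 - r.2) (r.1 - l.1) l := by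
  obtain ⟨τ, h₀, h₁, h₂, h₃⟩ := h.below
  have e₁ := mul_lt_mul_of_pos_left h₃ (sub_pos.2 h.lt_x)
  have e₂ : (l.2 - r.2) * ((1 + ε) * q.1) = (l.2 - r.2) * (l.1 + τ * (r.1 - l.1)) := by rw [h₂]
  simp only [linObj]
  linarith

/-- The apex of the triangle on the side of `e` after a split with weight `β`. -/
def cutPt (β : ℝ) (e s : ℝ × ℝ) : ℝ × ℝ := (1 - β) • e + β • s

lemma cutPt_fst (β : ℝ) (e s : ℝ × ℝ) : (cutPt β e s).1 = (1 - β) * e.1 + β * s.1 := by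
  simp [cutPt]

lemma cutPt_snd (β : ℝ) (e s : ℝ × ℝ) : (cutPt β e s).2 = (1 - β) * e.2 + β * s.2 := by
  simp [cutPt]

lemma linObj_cutPt (a c β : ℝ) (e s : ℝ × ℝ) :
    linObj a c (cutPt β e s) = (1 - β) * linObj a c e + β * linObj a c s := by
  simp only [linObj, cutPt_fst, cutPt_snd]; ring

variable {A : Set (ℝ × ℝ)} {ε : ℝ} {l r s q : ℝ × ℝ} {α β γ : ℝ}

/-- One lower side of the child lies on `ls`; the other is parallel to `lr` through the minimizer
`q`. So `A` stays above both. -/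
lemma IsSplit.isFrame_left (h : IsSplit A ε l r s q α β γ) (hf : IsFrame A l r s) :
    IsFrame A l q (cutPt β l s) := by
  obtain ⟨b₁, b₂, b₃, b₄, b₅, b₆⟩ := h.isBary
  have hα : α = 1 - β - γ := by linarith
  subst hα
  refine ⟨hf.left_mem, h.mem, ?_, ?_, ?_, ?_, fun w hw => ?_, fun w hw => ?_⟩
  · rw [cutPt_fst]; nlinarith [hf.left_x]
  · rw [cutPt_fst, b₅]; nlinarith [h.lt_x]
  · rw [cutPt_snd, b₆]; nlinarith [h.lt_y]
  · rw [cutPt_snd]; nlinarith [hf.left_y]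
  · have : lineHt l (cutPt β l s) w = β * lineHt l s w := by
      simp only [lineHt, cutPt_fst, cutPt_snd]; ring
    rw [this]; exact mul_nonneg b₂ (hf.above_left w hw)
  · have : lineHt (cutPt β l s) q w = γ * (lineHt l r w - lineHt l r q) := by
      simp only [lineHt, cutPt_fst, cutPt_snd, b₅, b₆]; ring
    rw [this]; exact mul_nonneg b₃ (sub_nonneg.2 (h.isMin w hw))

lemma IsSplit.isFrame_right (h : IsSplit A ε l r s q α β γ) (hf : IsFrame A l r s) :
    IsFrame A q r (cutPt β r s) := by
  obtain ⟨b₁, b₂, b₃, b₄, b₅, b₆⟩ := h.isBary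
  have hγ : γ = 1 - β - α := by linarith
  subst hγ
  refine ⟨h.mem, hf.right_mem, ?_, ?_, ?_, ?_, fun w hw => ?_, fun w hw => ?_⟩
  · rw [cutPt_fst, b₅]; nlinarith [h.lt_x]
  · rw [cutPt_fst]; nlinarith [hf.right_x]
  · rw [cutPt_snd]; nlinarith [hf.right_y]
  · rw [cutPt_snd, b₆]; nlinarith [h.lt_y]
  · have : lineHt q (cutPt β r s) w = α * (lineHt l r w - lineHt l r q) := by
      simp only [lineHt, cutPt_fst, cutPt_snd, b₅, b₆]; ring
    rw [this]; exact mul_nonneg b₁ (sub_nonneg.2 (h.isMin w hw))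
  · have : lineHt (cutPt β r s) r w = β * lineHt s r w := by
      simp only [lineHt, cutPt_fst, cutPt_snd]; ring
    rw [this]; exact mul_nonneg b₂ (hf.above_right w hw)

/-- The area factor of the child that drops `r`. As β + γ ≤ 1 it is at most 1/4, which makes the
recursion halt. -/
lemma IsBary.lineHt_left (h : IsBary l s r q α β γ) :
    lineHt l q (cutPt β l s) = β * γ * lineHt l r s := by
  obtain ⟨b₁, b₂, b₃, b₄, b₅, b₆⟩ := h
  have hα : α = 1 - β - γ := by linarith
  subst hα
  simp only [lineHt, cutPt_fst, cutPt_snd, b₅, b₆]; ring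

lemma IsBary.lineHt_right (h : IsBary l s r q α β γ) :
    lineHt q r (cutPt β r s) = β * α * lineHt l r s := by
  obtain ⟨b₁, b₂, b₃, b₄, b₅, b₆⟩ := h
  have hγ : γ = 1 - β - α := by linarith
  subst hγ
  simp only [lineHt, cutPt_fst, cutPt_snd, b₅, b₆]; ring

lemma IsBary.lineHt_eq (h : IsBary l s r q α β γ) : lineHt l r q = β * lineHt l r s := by
  obtain ⟨b₁, b₂, b₃, b₄, b₅, b₆⟩ := h
  have hα : α = 1 - β - γ := by linarith
  subst hα
  simp only [lineHt, b₅, b₆]; ring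

/-! ### Content and area of a triangle -/

/-- The points of `S` strictly below the line `lr`. -/
def content (S : Set (ℝ × ℝ)) (l r : ℝ × ℝ) : Set (ℝ × ℝ) := {w ∈ S | lineHt l r w < 0}

/-- The height over `lq` combines those over `lr` and `ls` with weights γ and β, and no point of `A`
lies below `ls`. -/
lemma IsSplit.content_left_subset {S : Set (ℝ × ℝ)} (h : IsSplit A ε l r s q α β γ)
    (hf : IsFrame A l r s) (hS : S ⊆ A) : content S l q ⊆ content S l r := by
  rintro w ⟨hw, hlt⟩
  refine ⟨hw, ?_⟩
  obtain ⟨b₁, b₂, b₃, b₄, b₅, b₆⟩ := h.isBary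
  have hα : α = 1 - β - γ := by linarith
  subst hα
  have e : lineHt l q w = γ * lineHt l r w + β * lineHt l s w := by
    simp only [lineHt, b₅, b₆]; ring
  by_contra! hc
  have := mul_nonneg b₃ hc
  have := mul_nonneg b₂ (hf.above_left w (hS hw))
  linarith

lemma IsSplit.content_right_subset {S : Set (ℝ × ℝ)} (h : IsSplit A ε l r s q α β γ)
    (hf : IsFrame A l r s) (hS : S ⊆ A) : content S q r ⊆ content S l r := by
  rintro w ⟨hw, hlt⟩
  refine ⟨hw, ?_⟩
  obtain ⟨b₁, b₂, b₃, b₄, b₅, b₆⟩ := h.isBary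
  have hγ : γ = 1 - β - α := by linarith
  subst hγ
  have e : lineHt q r w = α * lineHt l r w + β * lineHt s r w := by
    simp only [lineHt, b₅, b₆]; ring
  by_contra! hc
  have := mul_nonneg b₁ hc
  have := mul_nonneg b₂ (hf.above_right w (hS hw))
  linarith

/-- A point below both `lq` and `qr` would have a smaller objective than `q`. -/
lemma IsSplit.disjoint_content {S : Set (ℝ × ℝ)} (h : IsSplit A ε l r s q α β γ) (hS : S ⊆ A) :
    Disjoint (content S l q) (content S q r) := by
  rw [Set.disjoint_left]
  rintro w ⟨hw, h₁⟩ ⟨-, h₂⟩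
  have := h.isMin w (hS hw)
  linarith [lineHt_add_lineHt l r q w]

/-- Otherwise the hull of `S` stays on or above `lr`, while a point covering `q` must lie strictly
below it. -/
lemma IsSplit.content_nonempty {S : Set (ℝ × ℝ)} (h : IsSplit A ε l r s q α β γ)
    (hS : IsEpsCP ε A S) : (content S l r).Nonempty := by
  by_contra! hc
  obtain ⟨z, hz, hcov⟩ := hS.2 q h.mem
  have h₁ := linObj_le_of_epsCovers (sub_pos.2 h.lt_y).le (sub_pos.2 h.lt_x).le hcov
  have h₂ : linObj (l.2 - r.2) (r.1 - l.1) l ≤ linObj (l.2 - r.2) (r.1 - l.1) z := by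
    refine le_linObj_of_mem_convexHull (fun w hw => ?_) hz
    by_contra! hlt
    have hmem : w ∈ content S l r := ⟨hw, by rw [lineHt_eq_linObj]; linarith⟩
    simp [hc] at hmem
  linarith [h.linObj_lt]

/-- A triangle that is split has area at least of order `(ε κ)²` if `κ` bounds the coordinates of
the points of `A` from below. -/
lemma IsSplit.area_gt {κ : ℝ} (h : IsSplit A ε l r s q α β γ) (hf : IsFrame A l r s)
    (hε : 0 < ε) (hκ : 0 < κ) (hA : ∀ p ∈ A, κ ≤ p.1 ∧ κ ≤ p.2) :
    ε ^ 2 * κ ^ 2 < -lineHt l r s := by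
  have h₁ := h.linObj_lt
  have h₂ := hf.apex_le h.mem
  rw [lineHt_eq_linObj l r q] at h₂
  obtain ⟨q₁, q₂⟩ := hA q h.mem
  -- `(1 + ε) * q.1 < r.1` forces this width, and the area exceeds ε times the objective of `q`.
  have h₃ : ε * κ ≤ r.1 - l.1 := by nlinarith [h.left_x hf, h.right_x]
  have h₄ : ε * κ * κ ≤ (r.1 - l.1) * q.2 := mul_le_mul h₃ q₂ hκ.le (sub_pos.2 h.lt_x).le
  have h₅ : 0 ≤ (l.2 - r.2) * q.1 := mul_nonneg (sub_pos.2 h.lt_y).le (hκ.le.trans q₁)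
  have h₆ : ε * (ε * κ * κ) ≤ ε * linObj (l.2 - r.2) (r.1 - l.1) q :=
    mul_le_mul_of_nonneg_left (by rw [linObj]; linarith) hε.le
  linarith

end ChordAlg

/-! ### Fans: the rise of a moving endpoint -/

namespace ChordAlg

/-- The state of the steps that replace the endpoint `f` of the triangle with endpoints `e`, `f`
and apex `s`, measured by the objective with coefficients `a`, `c`. It rises at `f` from `M` by
`σ` in units of `ε * M`, and rises by at least `b` in these units from `f` to `s`. The set `C`
holds the points of `S` below the line `ef`. -/
structure IsFan (ε : ℝ) (S C : Set (ℝ × ℝ)) (e f s : ℝ × ℝ) (σ b a c M : ℝ) : Prop where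
  nonneg₁ : 0 ≤ a
  nonneg₂ : 0 ≤ c
  pos : 0 < M
  rise_nonneg : 0 ≤ σ
  gap_nonneg : 0 ≤ b
  base : M * (1 + ε * σ) ≤ linObj a c f
  gap : linObj a c f + b * (ε * M) ≤ linObj a c s
  top : linObj a c s ≤ linObj a c e
  hull : ∃ z ∈ convexHull ℝ S, linObj a c z ≤ (1 + ε) * M
  out : ∀ w ∈ S, w ∉ C → linObj a c e ≤ linObj a c w

variable {ε : ℝ} {S C : Set (ℝ × ℝ)} {e f s q : ℝ × ℝ} {σ b a c M α β γ : ℝ}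

lemma IsFan.base_le (h : IsFan ε S C e f s σ b a c M) (hε : 0 ≤ ε) : M ≤ linObj a c f := by
  have : 0 ≤ M * (ε * σ) := mul_nonneg h.pos.le (mul_nonneg hε h.rise_nonneg)
  linarith [h.base]

lemma IsFan.le_apex (h : IsFan ε S C e f s σ b a c M) (hε : 0 ≤ ε) :
    linObj a c f ≤ linObj a c s := by
  have : 0 ≤ b * (ε * M) := mul_nonneg h.gap_nonneg (mul_nonneg hε h.pos.le)
  linarith [h.gap]

/-- The value at the endpoint rises by at least β times the old gap. The new apex exceeds `q` by γ
times the difference between `e` and `f`, which is at least εM because `q` is uncovered. So the gap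
restarts at γ, whatever it was. -/
lemma IsFan.near (h : IsFan ε S C e f s σ b a c M) (hε : 0 ≤ ε) (hq : IsBary e s f q α β γ)
    (hunc : (1 + ε) * linObj a c q ≤ max (linObj a c e) (linObj a c f)) :
    IsFan ε S C e q (cutPt β e s) (σ + β * b) γ a c M := by
  have hfs := h.le_apex hε
  have hfe := hfs.trans h.top
  rw [max_eq_left hfe] at hunc
  have hMq : M ≤ linObj a c q :=
    hq.le_linObj ((h.base_le hε).trans hfe) ((h.base_le hε).trans hfs) (h.base_le hε)
  have hfq : linObj a c f ≤ linObj a c q := hq.le_linObj hfe hfs le_rfl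
  have hα : α = 1 - β - γ := by linarith [hq.sum_eq]
  subst hα
  have hqe := hq.linObj_eq a c
  have hεM := mul_le_mul_of_nonneg_left hMq hε
  refine ⟨h.nonneg₁, h.nonneg₂, h.pos, ?_, hq.nonneg₃, ?_, ?_, ?_, h.hull, h.out⟩
  · exact add_nonneg h.rise_nonneg (mul_nonneg hq.nonneg₂ h.gap_nonneg)
  · have h₁ := mul_le_mul_of_nonneg_left h.gap hq.nonneg₂
    have h₂ := mul_le_mul_of_nonneg_left hfe hq.nonneg₁
    linarith [h.base]
  · rw [linObj_cutPt]
    have h₁ : γ * (ε * M) ≤ γ * (linObj a c e - linObj a c f) :=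
      mul_le_mul_of_nonneg_left (by linarith) hq.nonneg₃
    linarith
  · rw [linObj_cutPt]
    have h₁ := mul_le_mul_of_nonneg_left h.top hq.nonneg₂
    linarith

/-- The endpoint `f` stays, and the new apex is at the fraction β of the way from `f` to `s`. -/
lemma IsFan.far (h : IsFan ε S C e f s σ b a c M) (hε : 0 ≤ ε) (hq : IsBary e s f q α β γ) :
    IsFan ε S C q f (cutPt β f s) σ (β * b) a c M := by
  have hfs := h.le_apex hε
  have hfe := hfs.trans h.top
  have hγ : γ = 1 - β - α := by linarith [hq.sum_eq]
  subst hγ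
  have hqe := hq.linObj_eq a c
  have h₁ := mul_le_mul_of_nonneg_left hfe hq.nonneg₁
  refine ⟨h.nonneg₁, h.nonneg₂, h.pos, h.rise_nonneg, mul_nonneg hq.nonneg₂ h.gap_nonneg, h.base,
    ?_, ?_, h.hull, fun w hw hwC => le_trans ?_ (h.out w hw hwC)⟩
  · rw [linObj_cutPt]
    have := mul_le_mul_of_nonneg_left h.gap hq.nonneg₂
    linarith
  · rw [linObj_cutPt]; linarith
  · have h₂ := mul_le_mul_of_nonneg_left h.top hq.nonneg₂
    have h₃ := mul_le_mul_of_nonneg_left hfe hq.nonneg₃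
    linarith

/-- Every point of `S` has objective at least that of `f`: the content because it lies in the
triangle, the rest by `out`. The hull point is at most (1 + ε)M. -/
lemma IsFan.rise_le_one (h : IsFan ε S C e f s σ b a c M) (hε : 0 < ε)
    (hC : ∀ w ∈ C, ∃ α β γ : ℝ, IsBary e s f w α β γ) : σ ≤ 1 := by
  have hfs := h.le_apex hε.le
  obtain ⟨z, hz, hzM⟩ := h.hull
  have hz' : linObj a c f ≤ linObj a c z := by
    refine le_linObj_of_mem_convexHull (fun w hw => ?_) hz
    by_cases hwC : w ∈ C
    · obtain ⟨α, β, γ, hb⟩ := hC w hwC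
      exact hb.le_linObj (hfs.trans h.top) hfs le_rfl
    · exact (hfs.trans h.top).trans (h.out w hw hwC)
  have h₁ : ε * M * σ ≤ ε * M * 1 := by linarith [h.base]
  exact le_of_mul_le_mul_left h₁ (mul_pos hε h.pos)

/-- What the analysis of a chain needs to know about one step: the line through `e` and `f` is a
level line of a monotone objective, and `q` is far below it. -/
structure IsStep (ε : ℝ) (S C : Set (ℝ × ℝ)) (e f s q : ℝ × ℝ) (α β γ : ℝ) : Prop where
  isBary : IsBary e s f q α β γ
  le_max : ∀ a c : ℝ, 0 ≤ a → 0 ≤ c →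
    (1 + ε) * linObj a c q ≤ max (linObj a c e) (linObj a c f)
  line : ∃ a c : ℝ, 0 ≤ a ∧ 0 ≤ c ∧ linObj a c e = linObj a c f ∧ 0 < linObj a c q ∧
    linObj a c q ≤ linObj a c e ∧ ∀ w ∈ S, w ∉ C → linObj a c e ≤ linObj a c w
  hull : ∃ z ∈ convexHull ℝ S, EpsCovers ε z q

lemma IsStep.symm (h : IsStep ε S C e f s q α β γ) : IsStep ε S C f e s q γ β α := by
  obtain ⟨a, c, h₁, h₂, h₃, h₄, h₅, h₆⟩ := h.line
  refine ⟨h.isBary.symm, fun a c ha hc => ?_, ⟨a, c, h₁, h₂, h₃.symm, h₄, ?_, ?_⟩, h.hull⟩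
  · rw [max_comm]; exact h.le_max a c ha hc
  · rwa [← h₃]
  · rwa [← h₃]

/-- The objective is parallel to `ef`, so `q` and the new apex have equal value M: the gap starts at
zero. -/
lemma IsStep.isFan_start (h : IsStep ε S C e f s q α β γ) :
    ∃ a c M : ℝ, IsFan ε S C e q (cutPt β e s) 0 0 a c M := by
  obtain ⟨a, c, h₁, h₂, h₃, h₄, h₅, h₆⟩ := h.line
  obtain ⟨z, hz, hcov⟩ := h.hull
  have hq := h.isBary.linObj_eq a c
  have hα : α = 1 - β - γ := by linarith [h.isBary.sum_eq]
  subst hα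
  have hcut : linObj a c (cutPt β e s) = linObj a c q := by
    rw [linObj_cutPt, hq, ← h₃]; ring
  refine ⟨a, c, linObj a c q, h₁, h₂, h₄, le_rfl, le_rfl, ?_, ?_, ?_,
    ⟨z, hz, linObj_le_of_epsCovers h₁ h₂ hcov⟩, h₆⟩
  · simp
  · simp [hcut]
  · rwa [hcut]

/-- A fan that is possibly not yet started (`i = 0`). -/
def FanState (ε : ℝ) (S C : Set (ℝ × ℝ)) (e f s : ℝ × ℝ) (i : ℕ) (σ b : ℝ) : Prop :=
  (i = 0 ∧ σ = 0 ∧ b = 0) ∨ (i = 1 ∧ ∃ a c M : ℝ, IsFan ε S C e f s σ b a c M)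

lemma FanState.far {i : ℕ} (h : FanState ε S C e f s i σ b) (hε : 0 ≤ ε)
    (hq : IsStep ε S C e f s q α β γ) : FanState ε S C q f (cutPt β f s) i σ (β * b) := by
  rcases h with ⟨h₁, h₂, h₃⟩ | ⟨hi, a, c, M, h⟩
  · exact Or.inl ⟨h₁, h₂, by simp [h₃]⟩
  · exact Or.inr ⟨hi, a, c, M, h.far hε hq.isBary⟩

lemma FanState.near {i : ℕ} (h : FanState ε S C e f s i σ b) (hε : 0 ≤ ε)
    (hq : IsStep ε S C e f s q α β γ) :
    (i = 0 ∧ σ = 0 ∧ FanState ε S C e q (cutPt β e s) 1 0 0) ∨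
      (i = 1 ∧ FanState ε S C e q (cutPt β e s) 1 (σ + β * b) γ ∧ 0 ≤ β * b) := by
  rcases h with ⟨h₁, h₂, h₃⟩ | ⟨hi, a, c, M, h⟩
  · exact Or.inl ⟨h₁, h₂, Or.inr ⟨rfl, hq.isFan_start⟩⟩
  · exact Or.inr ⟨hi, Or.inr ⟨rfl, a, c, M,
      h.near hε hq.isBary (hq.le_max a c h.nonneg₁ h.nonneg₂)⟩,
      mul_nonneg hq.isBary.nonneg₂ h.gap_nonneg⟩

/-! ### Counting the steps of a chain -/

/-- Bookkeeping for a chain of `j` steps: `m` counts the steps with a small area factor and the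
started fans, `N` counts gains of `θ ^ 3`, and `k` is the readiness for the next gain. -/
def Progress (θ : ℝ) (j m : ℕ) (σ b σ' b' : ℝ) : Prop :=
  ∃ N k : ℕ, j ≤ 3 * m + k + 2 * N ∧ N * θ ^ 3 ≤ σ + σ' ∧
    (k = 0 ∨ (k = 1 ∧ (θ ≤ b ∨ θ ≤ b')) ∨ (k = 2 ∧ θ ^ 2 ≤ b ∧ θ ^ 2 ≤ b'))

variable {θ σ' b' : ℝ} {j m : ℕ}

lemma Progress.symm (h : Progress θ j m σ b σ' b') : Progress θ j m σ' b' σ b := by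
  obtain ⟨N, k, h₁, h₂, h₃⟩ := h
  refine ⟨N, k, h₁, by rwa [add_comm], ?_⟩
  rcases h₃ with h | ⟨h, h' | h'⟩ | ⟨h, h', h''⟩
  · exact Or.inl h
  · exact Or.inr (Or.inl ⟨h, Or.inr h'⟩)
  · exact Or.inr (Or.inl ⟨h, Or.inl h'⟩)
  · exact Or.inr (Or.inr ⟨h, h'', h'⟩)

/-- One step plus at most two lost units of readiness: hence the factor 3 in `Progress`. -/
lemma Progress.reset {m' : ℕ} {τ d τ' d' : ℝ} (h : Progress θ j m σ b σ' b') (hm : m + 1 ≤ m')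
    (hσ : σ + σ' ≤ τ + τ') : Progress θ (j + 1) m' τ d τ' d' := by
  obtain ⟨N, k, h₁, h₂, h₃⟩ := h
  have hk : k ≤ 2 := by omega
  exact ⟨N, 0, by omega, h₂.trans hσ, Or.inl rfl⟩

/-- A gap of at least θ² at the replaced endpoint yields a gain of at least θ³. In any case this gap
becomes at least θ, and the other one loses only the factor β. So two steps prepare a gain, and each
gain leaves readiness 1. -/
lemma Progress.near (h : Progress θ j m σ b σ' b') (hθ : 0 ≤ θ) (hθ₁ : θ ≤ 1) (hβ : θ ≤ β)
    (hγ : θ ≤ γ) (hb : 0 ≤ β * b) : Progress θ (j + 1) m (σ + β * b) γ σ' (β * b') := by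
  obtain ⟨N, k, h₁, h₂, h₃⟩ := h
  have gain : ∀ x : ℝ, θ ^ 2 ≤ x → θ ^ 3 ≤ β * x := fun x hx => by
    have := mul_le_mul hβ hx (by positivity) (hθ.trans hβ)
    linarith [pow_succ' θ 2]
  have hθ₂ : θ ^ 2 ≤ θ := by nlinarith
  rcases h₃ with rfl | ⟨rfl, h' | h'⟩ | ⟨rfl, h', h''⟩
  · exact ⟨N, 1, by omega, by linarith, Or.inr (Or.inl ⟨rfl, Or.inl hγ⟩)⟩
  · refine ⟨N + 1, 1, by omega, ?_, Or.inr (Or.inl ⟨rfl, Or.inl hγ⟩)⟩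
    push_cast
    linarith [gain b (hθ₂.trans h')]
  · refine ⟨N, 2, by omega, by linarith, Or.inr (Or.inr ⟨rfl, hθ₂.trans hγ, ?_⟩)⟩
    rw [sq]; exact mul_le_mul hβ h' hθ (hθ.trans hβ)
  · refine ⟨N + 1, 1, by omega, ?_, Or.inr (Or.inl ⟨rfl, Or.inl hγ⟩)⟩
    push_cast
    linarith [gain b h']

/-- The history of a chain of `j` steps that ends at the triangle with endpoints `e`, `f` and
apex `s` of area `D`, and began with a triangle of area at most `D₀`. -/
def History (θ D₀ ε : ℝ) (S C : Set (ℝ × ℝ)) (D : ℝ) (e f s : ℝ × ℝ) (j : ℕ) : Prop :=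
  ∃ (g i i' : ℕ) (σ b σ' b' : ℝ), D ≤ D₀ * θ ^ g ∧ FanState ε S C e f s i σ b ∧
    FanState ε S C f e s i' σ' b' ∧ Progress θ j (g + i + i') σ b σ' b'

variable {D₀ D : ℝ}

lemma History.start (hD : D ≤ D₀) : History θ D₀ ε S C D e f s 0 :=
  ⟨0, 0, 0, 0, 0, 0, 0, by simpa using hD, Or.inl ⟨rfl, rfl, rfl⟩, Or.inl ⟨rfl, rfl, rfl⟩,
    0, 0, by simp, by simp, Or.inl rfl⟩

lemma History.symm (h : History θ D₀ ε S C D e f s j) : History θ D₀ ε S C D f e s j := by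
  obtain ⟨g, i, i', σ, b, σ', b', h₁, h₂, h₃, h₄⟩ := h
  exact ⟨g, i', i, σ', b', σ, b, h₁, h₃, h₂, by rw [add_right_comm]; exact h₄.symm⟩

lemma History.step (h : History θ D₀ ε S C D e f s j) (hε : 0 ≤ ε) (hθ : 0 ≤ θ) (hθ₁ : θ ≤ 1)
    (hD : 0 ≤ D) (hq : IsStep ε S C e f s q α β γ) :
    History θ D₀ ε S C (β * γ * D) e q (cutPt β e s) (j + 1) := by
  obtain ⟨g, i, i', σ, b, σ', b', h₁, h₂, h₃, h₄⟩ := h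
  obtain ⟨b₁, b₂, b₃, b₄, -, -⟩ := hq.isBary
  have hβ : β ≤ 1 := by linarith
  have hγ : γ ≤ 1 := by linarith
  have hβγ : β * γ ≤ 1 := mul_le_one₀ hβ b₃ hγ
  have hfar := h₃.far hε hq.symm
  have hnear := h₂.near hε hq
  -- A small area factor or a newly started fan is charged to `m`. Otherwise β and γ are both at
  -- least θ, since neither exceeds 1.
  rcases lt_or_ge (β * γ) θ with hlt | hge
  · have hD' : β * γ * D ≤ D₀ * θ ^ (g + 1) := by
      calc β * γ * D ≤ θ * (D₀ * θ ^ g) := mul_le_mul hlt.le h₁ hD hθ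
        _ = _ := by ring
    rcases hnear with ⟨rfl, rfl, hn⟩ | ⟨rfl, hn, hb⟩
    · exact ⟨g + 1, 1, i', 0, 0, σ', β * b', hD', hn, hfar, h₄.reset (by omega) le_rfl⟩
    · exact ⟨g + 1, 1, i', _, _, σ', β * b', hD', hn, hfar,
        h₄.reset (by omega) (by linarith)⟩
  · have hD' : β * γ * D ≤ D₀ * θ ^ g := (mul_le_of_le_one_left hD hβγ).trans h₁
    rcases hnear with ⟨rfl, rfl, hn⟩ | ⟨rfl, hn, hb⟩
    · exact ⟨g, 1, i', 0, 0, σ', β * b', hD', hn, hfar, h₄.reset (by omega) le_rfl⟩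
    · exact ⟨g, 1, i', _, _, σ', β * b', hD', hn, hfar,
        h₄.near hθ hθ₁ (by nlinarith) (by nlinarith) hb⟩

lemma FanState.bounds {i : ℕ} (h : FanState ε S C e f s i σ b) (hε : 0 < ε)
    (hC : ∀ w ∈ C, ∃ α β γ : ℝ, IsBary e s f w α β γ) : i ≤ 1 ∧ σ ≤ 1 := by
  rcases h with ⟨rfl, rfl, -⟩ | ⟨rfl, a, c, M, h⟩
  · exact ⟨zero_le_one, zero_le_one⟩
  · exact ⟨le_rfl, h.rise_le_one hε hC⟩

lemma History.length_le (h : History θ D₀ ε S C D e f s j) (hε : 0 < ε)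
    (hC : ∀ w ∈ C, ∃ α β γ : ℝ, IsBary e s f w α β γ) :
    ∃ g N : ℕ, j ≤ 3 * g + 2 * N + 8 ∧ D ≤ D₀ * θ ^ g ∧ N * θ ^ 3 ≤ 2 := by
  obtain ⟨g, i, i', σ, b, σ', b', h₁, h₂, h₃, N, k, h₄, h₅, h₆⟩ := h
  obtain ⟨hi, hσ⟩ := h₂.bounds hε hC
  obtain ⟨hi', hσ'⟩ := h₃.bounds hε fun w hw => by
    obtain ⟨α, β, γ, hb⟩ := hC w hw
    exact ⟨γ, β, α, hb.symm⟩
  have hk : k ≤ 2 := by omega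
  -- Two fans and the leftover readiness: 3 · 2 + 2 = 8.
  exact ⟨g, N, by omega, h₁, by linarith⟩

end ChordAlg

/-! ### Counting splits over the recursion -/

namespace ChordAlg

variable {A S : Set (ℝ × ℝ)} {ε θ D₀ κ : ℝ} {l r s q : ℝ × ℝ} {α β γ : ℝ}

lemma IsSplit.isStep (h : IsSplit A ε l r s q α β γ) (hS : IsEpsCP ε A S) (hε : 0 ≤ ε)
    (hA : ∀ p ∈ A, 0 < p.1 ∧ 0 < p.2) : IsStep ε S (content S l r) l r s q α β γ := by
  have hx := sub_pos.2 h.lt_x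
  have hy := sub_pos.2 h.lt_y
  have hpos : 0 < linObj (l.2 - r.2) (r.1 - l.1) q :=
    add_pos (mul_pos hy (hA q h.mem).1) (mul_pos hx (hA q h.mem).2)
  refine ⟨h.isBary, fun a c _ hc => h.linObj_le_max hc, ⟨l.2 - r.2, r.1 - l.1, hy.le, hx.le, ?_,
    hpos, ?_, fun w hw hwC => ?_⟩, hS.2 q h.mem⟩
  · simp only [linObj]; ring
  · have := h.linObj_lt
    nlinarith
  · by_contra! hlt
    exact hwC ⟨hw, by rw [lineHt_eq_linObj]; linarith⟩

lemma IsFrame.exists_isBary_of_mem_content (hf : IsFrame A l r s) (hS : S ⊆ A) :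
    ∀ w ∈ content S l r, ∃ α β γ : ℝ, IsBary l s r w α β γ := by
  rintro w ⟨hw, hlt⟩
  obtain ⟨α, β, γ, h, -⟩ :=
    hf.exists_isBary (hS hw) ((hf.apex_le (hS hw)).trans_lt hlt) hlt.le
  exact ⟨α, β, γ, h⟩

/-- A history continues only while the content is unchanged; otherwise a new one starts with length
0. -/
lemma History.child {C C' : Set (ℝ × ℝ)} {D' : ℝ} {e' f' s' : ℝ × ℝ} {j B : ℕ}
    (h : C' = C → History θ D₀ ε S C D' e' f' s' (j + 1)) (hD : D' ≤ D₀) (hj : j + 1 ≤ B) :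
    ∃ j' ≤ B, History θ D₀ ε S C' D' e' f' s' j' ∧ (C' = C → j' = j + 1) := by
  by_cases hC : C' = C
  · exact ⟨j + 1, hj, hC ▸ h hC, fun _ => rfl⟩
  · exact ⟨0, Nat.zero_le _, History.start hD, fun h' => absurd h' hC⟩

/-- The potential `2 * B * c - B - j` bounds the splits below a triangle with content size `c` at
position `j` of its chain. A strict loss of content, or a division into two nonempty parts, frees
enough to restart chains at 0. -/
lemma count_split_le {B j c c₁ c₂ N₁ N₂ j₁ j₂ : ℕ} (hc : 0 < c) (hcc : c₁ + c₂ ≤ c)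
    (hj : j + 1 ≤ B) (h₁ : c₁ = c → j₁ = j + 1) (h₂ : c₂ = c → j₂ = j + 1)
    (hz₁ : c₁ = 0 → N₁ = 0) (hz₂ : c₂ = 0 → N₂ = 0)
    (hp₁ : 0 < c₁ → N₁ + j₁ + B ≤ 2 * (B * c₁)) (hp₂ : 0 < c₂ → N₂ + j₂ + B ≤ 2 * (B * c₂)) :
    N₁ + N₂ + 1 + j + B ≤ 2 * (B * c) := by
  have hBc : B * 1 ≤ B * c := Nat.mul_le_mul_left B hc
  have hsum : B * c₁ + B * c₂ ≤ B * c := by rw [← mul_add]; exact Nat.mul_le_mul_left B hcc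
  have hlt : ∀ x, x < c → B * x + B ≤ B * c := fun x hx => by
    rw [← Nat.mul_succ]; exact Nat.mul_le_mul_left B hx
  rcases Nat.eq_zero_or_pos c₁ with z₁ | p₁ <;> rcases Nat.eq_zero_or_pos c₂ with z₂ | p₂
  · have := hz₁ z₁; have := hz₂ z₂; omega
  · have := hz₁ z₁; have := hp₂ p₂
    rcases eq_or_ne c₂ c with e | e
    · have := h₂ e; subst e; omega
    · have := hlt c₂ (by omega); omega
  · have := hz₂ z₂; have := hp₁ p₁
    rcases eq_or_ne c₁ c with e | e
    · have := h₁ e; subst e; omega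
    · have := hlt c₁ (by omega); omega
  · have := hp₁ p₁; have := hp₂ p₂; omega

/-- The routine halts, and a triangle whose content has `c` points causes at most about `2 B c`
splits, where `B` bounds the length of the chains of triangles of constant content. -/
theorem exists_chordRoutine {comb : ℝ≥0∞ → ℝ × ℝ} {B : ℕ}
    (hcomb : ∀ lam, comb lam ∈ A ∧ IsMinOn (combObj lam) A (comb lam))
    (hS : IsEpsCP ε A S) (hfin : S.Finite) (hε : 0 < ε) (hθ : 0 ≤ θ) (hθ₁ : θ ≤ 1) (hκ : 0 < κ)
    (hA : ∀ p ∈ A, κ ≤ p.1 ∧ κ ≤ p.2)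
    (hB : ∀ g N : ℕ, ε ^ 2 * κ ^ 2 < D₀ * θ ^ g → N * θ ^ 3 ≤ 2 → 3 * g + 2 * N + 8 < B)
    (d : ℕ) : ∀ (l r s : ℝ × ℝ) (j : ℕ), IsFrame A l r s →
      -lineHt l r s ≤ 4 ^ d * (ε ^ 2 * κ ^ 2) → -lineHt l r s ≤ D₀ →
      History θ D₀ ε S (content S l r) (-lineHt l r s) l r s j → j ≤ B →
      ∃ (Q : Set (ℝ × ℝ)) (k N : ℕ), ChordRoutine comb ε l r s Q k ∧ k ≤ 2 * N + 1 ∧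
        ((content S l r).ncard = 0 → N = 0) ∧
        (0 < (content S l r).ncard → N + j + B ≤ 2 * (B * (content S l r).ncard)) := by
  have hA₀ : ∀ p ∈ A, 0 < p.1 ∧ 0 < p.2 := fun p hp =>
    ⟨hκ.trans_le (hA p hp).1, hκ.trans_le (hA p hp).2⟩
  have hnosplit : ∀ {j c : ℕ}, j ≤ B → 0 < c → 0 + j + B ≤ 2 * (B * c) := fun hj hc => by
    have := Nat.mul_le_mul_left B hc
    omega
  -- Each split divides the area by at least 4, and a split triangle has area above `ε ^ 2 * κ ^ 2`;
  -- so `d` bounds the depth.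
  induction d with
  | zero =>
    intro l r s j hf hd _ _ hj
    rcases le_or_gt (ratioDistSeg s l r) ε with hs | hs
    · exact ⟨_, _, 0, ChordRoutine.covered l r s hs, by omega, fun _ => rfl, hnosplit hj⟩
    rcases le_or_gt (ratioDistSeg (comb (absSlope l r)) l r) ε with hq | hq
    · exact ⟨_, _, 0, ChordRoutine.leaf l r s hs hq, by omega, fun _ => rfl, hnosplit hj⟩
    obtain ⟨α, β, γ, h⟩ := hf.exists_isSplit hε.le hA₀ hs (hcomb _).1 (hcomb _).2 hq
    have := h.area_gt hf hε hκ hA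
    simp only [pow_zero, one_mul] at hd
    linarith
  | succ d ih =>
    intro l r s j hf hd hD hH hj
    rcases le_or_gt (ratioDistSeg s l r) ε with hs | hs
    · exact ⟨_, _, 0, ChordRoutine.covered l r s hs, by omega, fun _ => rfl, hnosplit hj⟩
    rcases le_or_gt (ratioDistSeg (comb (absSlope l r)) l r) ε with hq | hq
    · exact ⟨_, _, 0, ChordRoutine.leaf l r s hs hq, by omega, fun _ => rfl, hnosplit hj⟩
    obtain ⟨α, β, γ, h⟩ := hf.exists_isSplit hε.le hA₀ hs (hcomb _).1 (hcomb _).2 hq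
    set q := comb (absSlope l r) with hqdef
    have hjB : j + 1 ≤ B := by
      obtain ⟨g, N, h₁, h₂, h₃⟩ := hH.length_le hε (hf.exists_isBary_of_mem_content hS.1)
      have := hB g N ((h.area_gt hf hε hκ hA).trans_le h₂) h₃
      omega
    have hapex : 0 ≤ -lineHt l r s := by linarith [h.apex]
    obtain ⟨b₁, b₂, b₃, b₄, -, -⟩ := h.isBary
    have hγ : β * γ ≤ 1 / 4 := by nlinarith [sq_nonneg (β - 1 / 2)]
    have hα : β * α ≤ 1 / 4 := by nlinarith [sq_nonneg (β - 1 / 2)]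
    have area : ∀ x : ℝ, x ≤ 1 / 4 → x * (-lineHt l r s) ≤ 4 ^ d * (ε ^ 2 * κ ^ 2) ∧
        x * (-lineHt l r s) ≤ D₀ := fun x hx => by
      have := mul_le_mul_of_nonneg_right hx hapex
      rw [pow_succ] at hd
      constructor <;> linarith
    have hstep := h.isStep hS hε.le hA₀
    have eL : -lineHt l q (cutPt β l s) = β * γ * (-lineHt l r s) := by
      rw [h.isBary.lineHt_left]; ring
    have eR : -lineHt q r (cutPt β r s) = β * α * (-lineHt l r s) := by
      rw [h.isBary.lineHt_right]; ring
    have hCL := h.content_left_subset hf hS.1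
    have hCR := h.content_right_subset hf hS.1
    have hfinC : (content S l r).Finite := hfin.subset fun w hw => hw.1
    obtain ⟨jL, hjL, hHL, hL⟩ := History.child
      (C' := content S l q) (fun _ => hH.step hε.le hθ hθ₁ hapex hstep) (area _ hγ).2 hjB
    -- `History.step` keeps the first endpoint, so the right child is treated by reflection.
    obtain ⟨jR, hjR, hHR, hR⟩ := History.child
      (C' := content S q r) (fun _ => (hH.symm.step hε.le hθ hθ₁ hapex hstep.symm).symm)
      (area _ hα).2 hjB
    rw [← eL] at hHL
    rw [← eR] at hHR
    obtain ⟨QL, kL, NL, rL, hkL, zL, pL⟩ := ih l q _ jL (h.isFrame_left hf)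
      (by rw [eL]; exact (area _ hγ).1) (by rw [eL]; exact (area _ hγ).2) hHL hjL
    obtain ⟨QR, kR, NR, rR, hkR, zR, pR⟩ := ih q r _ jR (h.isFrame_right hf)
      (by rw [eR]; exact (area _ hα).1) (by rw [eR]; exact (area _ hα).2) hHR hjR
    have hc : 0 < (content S l r).ncard :=
      (Set.ncard_pos hfinC).2 (h.content_nonempty hS)
    have hsum : (content S l q).ncard + (content S q r).ncard ≤ (content S l r).ncard := by
      rw [← Set.ncard_union_eq (h.disjoint_content hS.1) (hfinC.subset hCL) (hfinC.subset hCR)]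
      exact Set.ncard_le_ncard (Set.union_subset hCL hCR) hfinC
    refine ⟨QL ∪ QR, 1 + kL + kR, NL + NR + 1, ?_, by omega, fun h0 => by omega, fun _ => ?_⟩
    · have hβ : β ≤ 1 := by linarith
      refine ChordRoutine.split l r s q (cutPt β l s) (cutPt β r s) QL QR kL kR hs hqdef hq
        ⟨⟨1 - β, β, by linarith, b₂, by ring, rfl⟩, ?_⟩
        ⟨⟨1 - β, β, by linarith, b₂, by ring, rfl⟩, ?_⟩ rL rR
      · rw [← lineHt_eq_iff_combObj h.lt_x h.lt_y, h.isBary.lineHt_eq]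
        simp only [lineHt, cutPt_fst, cutPt_snd]; ring
      · rw [← lineHt_eq_iff_combObj h.lt_x h.lt_y, h.isBary.lineHt_eq]
        simp only [lineHt, cutPt_fst, cutPt_snd]; ring
    · refine count_split_le hc hsum hjB (fun e => hL ?_) (fun e => hR ?_) zL zR pL pR
      · exact Set.eq_of_subset_of_ncard_le hCL e.ge hfinC
      · exact Set.eq_of_subset_of_ncard_le hCR e.ge hfinC

lemma combObj_top (p : ℝ × ℝ) : combObj ∞ p = p.1 := if_pos rfl

lemma combObj_zero (p : ℝ × ℝ) : combObj 0 p = p.2 := by simp [combObj]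

lemma isFrame_initial {a b : ℝ × ℝ} (ha : a ∈ A) (hb : b ∈ A)
    (ha' : IsMinOn (combObj ∞) A a) (hb' : IsMinOn (combObj 0) A b) :
    IsFrame A a b (a.1, b.2) := by
  have h₁ : ∀ w ∈ A, a.1 ≤ w.1 := fun w hw => by
    have h := isMinOn_iff.1 ha' w hw
    rwa [combObj_top, combObj_top] at h
  have h₂ : ∀ w ∈ A, b.2 ≤ w.2 := fun w hw => by
    have h := isMinOn_iff.1 hb' w hw
    rwa [combObj_zero, combObj_zero] at h
  refine ⟨ha, hb, le_rfl, h₁ b hb, le_rfl, h₂ a ha, fun w hw => ?_, fun w hw => ?_⟩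
  · have := mul_nonneg (sub_nonneg.2 (h₂ a ha)) (sub_nonneg.2 (h₁ w hw))
    simpa [lineHt] using this
  · have := mul_nonneg (sub_nonneg.2 (h₁ b hb)) (sub_nonneg.2 (h₂ w hw))
    simpa [lineHt] using this

theorem chordCalls_le {comb : ℝ≥0∞ → ℝ × ℝ} {B : ℕ} {K : ℝ}
    (hcomb : ∀ lam, comb lam ∈ A ∧ IsMinOn (combObj lam) A (comb lam))
    (hS : IsEpsCP ε A S) (hfin : S.Finite) (hε : 0 < ε) (hθ : 0 ≤ θ) (hθ₁ : θ ≤ 1) (hκ : 0 < κ)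
    (hA : ∀ p ∈ A, κ ≤ p.1 ∧ κ ≤ p.2) (hK : ∀ p ∈ A, p.1 ≤ K ∧ p.2 ≤ K)
    (hB : ∀ g N : ℕ, ε ^ 2 * κ ^ 2 < K ^ 2 * θ ^ g → N * θ ^ 3 ≤ 2 → 3 * g + 2 * N + 8 < B) :
    chordCalls comb ε ≤ ((4 * (B * S.ncard) + 3 : ℕ) : ℕ∞) := by
  obtain ⟨ha, ha'⟩ := hcomb ∞
  obtain ⟨hb, hb'⟩ := hcomb 0
  set a := comb ∞
  set b := comb 0
  have hf : IsFrame A a b (a.1, b.2) := isFrame_initial ha hb ha' hb'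
  have hD : -lineHt a b (a.1, b.2) ≤ K ^ 2 := by
    have e : -lineHt a b (a.1, b.2) = (b.1 - a.1) * (a.2 - b.2) := by simp only [lineHt]; ring
    have hx : 0 ≤ b.1 - a.1 := sub_nonneg.2 (hf.left_x.trans hf.right_x)
    rw [e, sq]
    refine mul_le_mul ?_ ?_ (sub_nonneg.2 (hf.right_y.trans hf.left_y)) ?_
    · linarith [(hK b hb).1, (hA a ha).1]
    · linarith [(hK a ha).2, (hA b hb).2]
    · linarith [(hK b hb).1, (hA b hb).1]
  have hδ : 0 < ε ^ 2 * κ ^ 2 := by positivity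
  obtain ⟨d, hd⟩ := pow_unbounded_of_one_lt (K ^ 2 / (ε ^ 2 * κ ^ 2)) (by norm_num : (1 : ℝ) < 4)
  rw [div_lt_iff₀ hδ] at hd
  obtain ⟨Q, k, N, hr, hk, h₀, h₁⟩ := exists_chordRoutine hcomb hS hfin hε hθ hθ₁ hκ hA hB d a b
    _ 0 hf (hD.trans hd.le) hD (History.start hD) (Nat.zero_le _)
  have hc : (content S a b).ncard ≤ S.ncard := Set.ncard_le_ncard (fun w hw => hw.1) hfin
  have hN : N ≤ 2 * (B * S.ncard) := by
    have := Nat.mul_le_mul_left B hc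
    rcases Nat.eq_zero_or_pos (content S a b).ncard with h | h
    · have := h₀ h; omega
    · have := h₁ h; omega
  refine (iInf₂_le (k + 2) ⟨Q, k, hr, rfl⟩).trans ?_
  exact_mod_cast (by omega : k + 2 ≤ 4 * (B * S.ncard) + 3)

/-! ### Choice of θ and the upper bound -/

/-- The numerical bound on the length of the chains. -/
lemma exists_chain_bound {m : ℝ} (hm : 1 ≤ m) (hε : 0 < ε) (hε' : ε < 1 / 2) :
    ∃ (B : ℕ) (θ : ℝ), 0 ≤ θ ∧ θ ≤ 1 ∧ (B : ℝ) ≤ 212 * chordRate m ε ∧ 1 ≤ B ∧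
      ∀ g N : ℕ, ε ^ 2 * ((2 : ℝ) ^ (-m)) ^ 2 < ((2 : ℝ) ^ m) ^ 2 * θ ^ g → N * θ ^ 3 ≤ 2 →
        3 * g + 2 * N + 8 < B := by
  set ℓ := Real.logb 2 (1 / ε) with hℓ
  have hℓ₁ : 1 < ℓ := by
    rw [hℓ, Real.lt_logb_iff_rpow_lt (by norm_num) (by positivity), Real.rpow_one,
      lt_div_iff₀ hε]
    linarith
  set L := m + ℓ with hL
  have hL₂ : 2 < L := by linarith
  have hL₀ : 0 < L := by linarith
  set Λ := Real.logb 2 L with hΛ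
  have hΛ₁ : 1 < Λ := by
    rwa [hΛ, Real.lt_logb_iff_rpow_lt (by norm_num) hL₀, Real.rpow_one]
  have hΛ₀ : 0 < Λ := by linarith
  have hlogle : ∀ y : ℝ, 0 < y → Real.logb 2 y ≤ 2 * y := fun y hy => by
    rw [Real.logb, div_le_iff₀ (by positivity)]
    have := Real.log_two_gt_d9
    have := Real.log_le_sub_one_of_pos hy
    nlinarith
  have hsq : √L * √L = L := Real.mul_self_sqrt hL₀.le
  have hsq₀ : 0 < √L := Real.sqrt_pos.2 hL₀
  have hΛsq : Λ ≤ 4 * √L := by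
    have h := hlogle _ hsq₀
    have e : Λ = 2 * Real.logb 2 (√L) := by
      rw [hΛ]; conv_lhs => rw [← hsq]
      rw [Real.logb_mul hsq₀.ne' hsq₀.ne']; ring
    linarith
  set X := L / Λ with hX
  have hX₁ : √L ≤ 4 * X := by
    rw [hX, mul_div_assoc', le_div_iff₀ hΛ₀]; nlinarith
  have hX₂ : 1 ≤ 2 * X := by
    rw [hX, mul_div_assoc', le_div_iff₀ hΛ₀]; linarith [hlogle L hL₀]
  have hrate : X ≤ 2 * chordRate m ε := by
    have e : chordRate m ε = L / (Real.logb 2 m + Real.logb 2 ℓ) := rfl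
    have h₁ : 0 ≤ Real.logb 2 m := Real.logb_nonneg (by norm_num) hm
    have h₂ : 0 < Real.logb 2 ℓ := Real.logb_pos (by norm_num) hℓ₁
    have h₃ : Real.logb 2 m ≤ Λ :=
      Real.logb_le_logb_of_le (by norm_num) (by linarith) (by linarith)
    have h₄ : Real.logb 2 ℓ ≤ Λ :=
      Real.logb_le_logb_of_le (by norm_num) (by linarith) (by linarith)
    rw [e, hX, mul_div_assoc', div_le_div_iff₀ hΛ₀ (by linarith)]
    nlinarith
  -- `θ ^ 3` is 1/√L, so N ≤ 2√L ≤ 8X; the areas give g < 24X; and 8 ≤ 16X. Thus 104 = 3 · 24 + 2 ·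
  -- 8 + 16.
  refine ⟨⌈104 * X⌉₊, L ^ (-(1 / 6) : ℝ), by positivity,
    Real.rpow_le_one_of_one_le_of_nonpos (by linarith) (by norm_num), ?_, ?_, ?_⟩
  · have := Nat.ceil_lt_add_one (by linarith : 0 ≤ 104 * X)
    linarith
  · rw [Nat.one_le_ceil_iff]; linarith
  · intro g N hg hN
    rw [← @Nat.cast_lt ℝ]
    refine lt_of_lt_of_le ?_ (Nat.le_ceil _)
    push_cast
    have hN' : (N : ℝ) ≤ 2 * √L := by
      have e : (L ^ (-(1 / 6) : ℝ)) ^ 3 = (√L)⁻¹ := by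
        rw [← Real.rpow_natCast, ← Real.rpow_mul hL₀.le, Real.sqrt_eq_rpow,
          ← Real.rpow_neg hL₀.le]
        norm_num
      rwa [e, ← div_eq_mul_inv, div_le_iff₀ hsq₀] at hN
    have hg' : (g : ℝ) * Λ < 24 * L := by
      have h := Real.logb_lt_logb (b := 2) (by norm_num) (by positivity) hg
      rw [Real.logb_mul (by positivity) (by positivity),
        Real.logb_mul (by positivity) (by positivity), Real.logb_pow, Real.logb_pow,
        Real.logb_pow, Real.logb_pow, Real.logb_rpow (by norm_num) (by norm_num),
        Real.logb_rpow (by norm_num) (by norm_num), Real.logb_rpow_eq_mul_logb_of_pos hL₀] at h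
      have e : ℓ = -Real.logb 2 ε := by rw [hℓ, one_div, Real.logb_inv]
      push_cast at h
      rw [← hΛ] at h
      linarith
    have hg'' : (g : ℝ) < 24 * X := by
      rw [hX, mul_div_assoc', lt_div_iff₀ hΛ₀]; exact hg'
    linarith

lemma exists_encard_eq_opt (ε : ℝ) (hε : 0 ≤ ε) (A : Set (ℝ × ℝ))
    (hA : ∀ p ∈ A, 0 < p.1 ∧ 0 < p.2) : ∃ S, IsEpsCP ε A S ∧ S.encard = opt ε A := by
  have hne : {S : Set (ℝ × ℝ) | IsEpsCP ε A S}.Nonempty := by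
    refine ⟨A, subset_rfl, fun p hp => ⟨p, subset_convexHull ℝ A hp, ?_, ?_⟩⟩
    · nlinarith [(hA p hp).1]
    · nlinarith [(hA p hp).2]
  have h := csInf_mem (hne.image Set.encard)
  rw [sInf_image] at h
  obtain ⟨S, hS, h⟩ := h
  exact ⟨S, hS, h⟩

theorem worstCaseRatio_le {Comb : Set (ℝ × ℝ) → ℝ≥0∞ → ℝ × ℝ} (hComb : IsExactComb Comb)
    {m : ℝ} (hm : 1 ≤ m) (hε : 0 < ε) (hε' : ε < 1 / 2) :
    worstCaseRatio Comb m ε ≤ ENNReal.ofReal (1484 * chordRate m ε) := by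
  obtain ⟨B, θ, hθ, hθ₁, hB, hB₁, hBound⟩ := exists_chain_bound hm hε hε'
  refine iSup₂_le fun A hA => ?_
  replace hA : IsInstance m A := hA
  have hκ : (0 : ℝ) < 2 ^ (-m) := by positivity
  have hlow : ∀ p ∈ A, (2 : ℝ) ^ (-m) ≤ p.1 ∧ (2 : ℝ) ^ (-m) ≤ p.2 := fun p hp =>
    ⟨(hA.bounded p hp).1.1, (hA.bounded p hp).2.1⟩
  obtain ⟨S, hS, hopt⟩ := exists_encard_eq_opt ε hε.le A fun p hp =>
    ⟨hκ.trans_le (hlow p hp).1, hκ.trans_le (hlow p hp).2⟩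
  rw [← hopt]
  rcases S.finite_or_infinite with hfin | hinf
  -- For infinite `S` the quotient is 0, even if the number of calls is infinite.
  swap
  · simp [hinf.encard_eq]
  have hcalls := chordCalls_le (K := 2 ^ m) (fun lam => hComb A lam (hA.exists_min lam)) hS hfin hε
    hθ hθ₁ hκ hlow (fun p hp => ⟨(hA.bounded p hp).1.2, (hA.bounded p hp).2.2⟩) hBound
  have hSne : S.Nonempty := by
    obtain ⟨p, hp⟩ := hA.nonempty
    obtain ⟨z, hz, -⟩ := hS.2 p hp
    exact convexHull_nonempty_iff.1 ⟨z, hz⟩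
  have hn : 1 ≤ S.ncard := (Set.ncard_pos hfin).2 hSne
  have hle : 4 * (B * S.ncard) + 3 ≤ 7 * B * S.ncard := by nlinarith
  refine ENNReal.div_le_of_le_mul ?_
  rw [← hfin.cast_ncard_eq]
  calc (chordCalls (Comb A) ε : ℝ≥0∞) ≤ ((7 * B * S.ncard : ℕ) : ℝ≥0∞) := by
        have h : chordCalls (Comb A) ε ≤ ((7 * B * S.ncard : ℕ) : ℕ∞) :=
          hcalls.trans (by exact_mod_cast hle)
        exact_mod_cast ENat.toENNReal_le.2 h
    _ = ENNReal.ofReal (7 * B) * (S.ncard : ℝ≥0∞) := by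
        rw [← ENNReal.ofReal_natCast, ← ENNReal.ofReal_natCast, ← ENNReal.ofReal_mul (by positivity)]
        push_cast; rfl
    _ ≤ _ := by
        rw [ENat.toENNReal_coe]
        exact mul_le_mul_left (ENNReal.ofReal_le_ofReal (by linarith)) _

end ChordAlg

/-! ### The staircase and the lower bound -/

namespace ChordAlg

/-- Only the left child is recorded: on the staircase it alone carries the lower bound. -/
lemma ChordRoutine.inversion {comb : ℝ≥0∞ → ℝ × ℝ} {ε : ℝ} {l r s : ℝ × ℝ} {Q : Set (ℝ × ℝ)}
    {n : ℕ} (h : ChordRoutine comb ε l r s Q n) : ratioDistSeg s l r ≤ ε ∨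
      ratioDistSeg (comb (absSlope l r)) l r ≤ ε ∨
      ∃ (sl : ℝ × ℝ) (Ql : Set (ℝ × ℝ)) (nl : ℕ), sl ∈ segment ℝ l s ∧
        combObj (absSlope l r) sl = combObj (absSlope l r) (comb (absSlope l r)) ∧
        ChordRoutine comb ε l (comb (absSlope l r)) sl Ql nl ∧ nl + 1 ≤ n := by
  cases h with
  | covered _ _ _ hs => exact Or.inl hs
  | leaf _ _ _ _ hq => exact Or.inr (Or.inl hq)
  | split _ _ _ q sl sr Ql Qr nl nr _ hcomb _ hsl _ hl _ =>
    subst hcomb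
    exact Or.inr (Or.inr ⟨sl, Ql, nl, hsl.1, hsl.2, hl, by omega⟩)

/-- The height over `lr` is linear and not constant along `ls`, so the intersection point is unique.
-/
lemma IsSplit.eq_cutPt {A : Set (ℝ × ℝ)} {ε : ℝ} {l r s q p : ℝ × ℝ} {α β γ : ℝ}
    (h : IsSplit A ε l r s q α β γ) (hp : p ∈ segment ℝ l s)
    (hpq : combObj (absSlope l r) p = combObj (absSlope l r) q) : p = cutPt β l s := by
  rw [← lineHt_eq_iff_combObj h.lt_x h.lt_y, h.isBary.lineHt_eq] at hpq
  obtain ⟨u, v, -, -, huv, rfl⟩ := hp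
  have hu : u = 1 - v := by linarith
  subst hu
  have e : lineHt l r ((1 - v) • l + v • s) = v * lineHt l r s := by
    change lineHt l r (cutPt v l s) = _
    simp only [lineHt, cutPt_fst, cutPt_snd]; ring
  rw [e] at hpq
  rw [mul_right_cancel₀ h.apex.ne hpq, cutPt]

/-- The left endpoint of the staircase instance. -/
def stairTop (X ε : ℝ) : ℝ × ℝ := (X, 1 + 4 * ε)

/-- The points of the staircase instance: their distance from the line `x = X` decreases by the
factor `K` from one to the next, and they rise slowly. -/
noncomputable def stairPt (X ε K : ℝ) (j : ℕ) : ℝ × ℝ := (X + (K ^ j)⁻¹, 1 + 4 * ε * (j / K))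

/-- The staircase instance. -/
def stairSet (X ε K : ℝ) (N : ℕ) : Set (ℝ × ℝ) :=
  insert (stairTop X ε) (stairPt X ε K '' {j | j ≤ N})

variable {X ε K : ℝ} {N k : ℕ}

lemma stairTop_mem : stairTop X ε ∈ stairSet X ε K N := Set.mem_insert _ _

lemma stairPt_mem {j : ℕ} (hj : j ≤ N) : stairPt X ε K j ∈ stairSet X ε K N :=
  Set.mem_insert_of_mem _ ⟨j, hj, rfl⟩

lemma finite_stairSet : (stairSet X ε K N).Finite :=
  ((Set.finite_le_nat N).image _).insert _

/-- The height of the `j`-th point above the line through the top and the `k`-th point, up to a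
factor. -/
lemma lineHt_stairPt (hK : 0 < K) (j : ℕ) :
    lineHt (stairTop X ε) (stairPt X ε K k) (stairPt X ε K j) =
      4 * ε * (K ^ k)⁻¹ * ((1 - k / K) * (K ^ k * (K ^ j)⁻¹) + j / K - 1) := by
  have := pow_ne_zero k hK.ne'
  simp only [lineHt, stairTop, stairPt]
  field_simp; ring

lemma stair_factor_succ_le (hK : 0 < K) :
    (1 - k / K) * (K ^ k * (K ^ (k + 1))⁻¹) + ((k + 1 : ℕ) : ℝ) / K - 1 ≤ (k + 2) / K - 1 := by
  have e : K ^ k * (K ^ (k + 1))⁻¹ = 1 / K := by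
    have := pow_ne_zero k hK.ne'
    rw [pow_succ]; field_simp
  rw [e]
  have h₁ : 0 ≤ (k : ℝ) / K * (1 / K) := by positivity
  have h₂ : ((k : ℝ) + 2) / K = ((k + 1 : ℕ) : ℝ) / K + 1 / K := by push_cast; ring
  rw [h₂]; linarith

lemma stair_add_two_div_le (hN : 4 * (N : ℝ) ≤ K) (hK : 8 ≤ K) (hk : k < N) :
    ((k : ℝ) + 2) / K ≤ 3 / 8 := by
  have : (k : ℝ) + 1 ≤ N := by exact_mod_cast hk
  rw [div_le_iff₀ (by linarith)]; linarith

/-- The bracket of `lineHt_stairPt` is at most (k + 2)/K - 1 ≤ -5/8 at k + 1. It is at least -k/K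
for j ≤ k and exceeds (k + 2)/K - 1 for j ≥ k + 2. -/
lemma lineHt_stairPt_succ_lt (hε : 0 < ε) (hN : 4 * (N : ℝ) ≤ K) (hK : 8 ≤ K) (hk : k < N) {j : ℕ}
    (hj : j ≠ k + 1) :
    lineHt (stairTop X ε) (stairPt X ε K k) (stairPt X ε K (k + 1)) <
      lineHt (stairTop X ε) (stairPt X ε K k) (stairPt X ε K j) := by
  have hK₀ : 0 < K := by linarith
  rw [lineHt_stairPt hK₀, lineHt_stairPt hK₀]
  refine mul_lt_mul_of_pos_left ((stair_factor_succ_le hK₀).trans_lt ?_) (by positivity)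
  have h₁ := stair_add_two_div_le hN hK hk
  have h₂ : (k : ℝ) / K < 1 := by
    have : (k : ℝ) + 1 ≤ N := by exact_mod_cast hk
    rw [div_lt_one hK₀]; linarith
  rcases lt_or_ge j (k + 1) with hlt | hge
  · have e : 1 ≤ K ^ k * (K ^ j)⁻¹ := by
      rw [← div_eq_mul_inv, one_le_div (by positivity)]
      exact pow_le_pow_right₀ (by linarith) (by omega)
    have h₃ : (1 - k / K) * 1 ≤ (1 - k / K) * (K ^ k * (K ^ j)⁻¹) :=
      mul_le_mul_of_nonneg_left e (by linarith)
    have h₄ : 0 ≤ (j : ℝ) / K := by positivity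
    have h₅ : (k : ℝ) / K ≤ (k + 2) / K := by gcongr; linarith
    linarith
  · have h₃ : 0 < (1 - k / K) * (K ^ k * (K ^ j)⁻¹) := mul_pos (by linarith) (by positivity)
    have h₄ : ((k : ℝ) + 2) / K ≤ j / K := by
      have : ((k + 2 : ℕ) : ℝ) ≤ j := by exact_mod_cast (by omega : k + 2 ≤ j)
      push_cast at this
      gcongr
    linarith

lemma lineHt_stairPt_succ_le (hε : 0 < ε) (hN : 4 * (N : ℝ) ≤ K) (hK : 8 ≤ K) (hk : k < N) :
    lineHt (stairTop X ε) (stairPt X ε K k) (stairPt X ε K (k + 1)) ≤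
      4 * ε * (K ^ k)⁻¹ * (-(5 / 8)) := by
  have hK₀ : 0 < K := by linarith
  rw [lineHt_stairPt hK₀]
  refine mul_le_mul_of_nonneg_left ((stair_factor_succ_le hK₀).trans ?_) (by positivity)
  linarith [stair_add_two_div_le hN hK hk]

lemma eq_stairPt_succ (hε : 0 < ε) (hN : 4 * (N : ℝ) ≤ K) (hK : 8 ≤ K) (hk : k < N)
    {q : ℝ × ℝ} (hq : q ∈ stairSet X ε K N)
    (hle : lineHt (stairTop X ε) (stairPt X ε K k) q ≤
      lineHt (stairTop X ε) (stairPt X ε K k) (stairPt X ε K (k + 1))) :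
    q = stairPt X ε K (k + 1) := by
  have hK₀ : 0 < K := by linarith
  rcases hq with rfl | ⟨j, -, rfl⟩
  · have h₁ := lineHt_stairPt_succ_le (X := X) hε hN hK hk
    have h₂ : 0 < 4 * ε * (K ^ k)⁻¹ := by positivity
    have h₃ : lineHt (stairTop X ε) (stairPt X ε K k) (stairTop X ε) = 0 := by simp [lineHt]
    linarith
  · by_contra hne
    have hj : j ≠ k + 1 := fun h => hne (by rw [h])
    exact (lineHt_stairPt_succ_lt hε hN hK hk hj).not_ge hle

/-- Even after scaling by `1 + ε` the next point is below the current line. -/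
lemma scaled_stairPt_lt (hε : 0 < ε) (hε' : ε ≤ 1 / 8) (hX : 0 < X) (hN : 4 * (N : ℝ) ≤ K)
    (hK : 8 ≤ K) (hk : k < N) (hsep : 4 * ε * X ≤ (K ^ k)⁻¹) :
    (1 + ε) * linObj (4 * ε * (1 - k / K)) ((K ^ k)⁻¹) (stairPt X ε K (k + 1)) <
      linObj (4 * ε * (1 - k / K)) ((K ^ k)⁻¹) (stairTop X ε) := by
  have hK₀ : 0 < K := by linarith
  have h₁ := lineHt_stairPt_succ_le (X := X) hε hN hK hk
  have h₂ := stair_add_two_div_le hN hK hk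
  set W := (K ^ k)⁻¹ with hW
  have hW₀ : 0 < W := by positivity
  have e₁ : lineHt (stairTop X ε) (stairPt X ε K k) (stairPt X ε K (k + 1)) =
      linObj (4 * ε * (1 - k / K)) W (stairPt X ε K (k + 1)) -
        linObj (4 * ε * (1 - k / K)) W (stairTop X ε) := by
    rw [lineHt_eq_linObj]
    congr 2 <;> simp only [stairTop, stairPt] <;> ring
  rw [e₁] at h₁
  have e₂ : linObj (4 * ε * (1 - k / K)) W (stairPt X ε K (k + 1)) =
      4 * ε * (1 - k / K) * (X + W * K⁻¹) + W * (1 + 4 * ε * (((k + 1 : ℕ) : ℝ) / K)) := by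
    simp only [linObj, stairPt, hW, pow_succ, mul_inv]
  have h₃ : 0 ≤ (k : ℝ) / K := by positivity
  have h₄ : (k : ℝ) / K ≤ 1 := h₂.trans' (by gcongr; linarith) |>.trans (by norm_num)
  have h₅ : ((k + 1 : ℕ) : ℝ) / K ≤ 3 / 8 := h₂.trans' (by push_cast; gcongr; norm_num)
  have h₆ : K⁻¹ ≤ 1 / 8 := by rw [one_div]; exact inv_anti₀ (by norm_num) hK
  have h₇ : 4 * ε * (1 - k / K) * (X + W * K⁻¹) ≤ 4 * ε * 1 * (X + W * (1 / 8)) := by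
    gcongr
    linarith
  have h₈ : W * (1 + 4 * ε * (((k + 1 : ℕ) : ℝ) / K)) ≤ W * (1 + 4 * (1 / 8) * (3 / 8)) := by
    gcongr
  have h₉ : ε * W ≤ 1 / 8 * W := by gcongr
  have h₁₀ : linObj (4 * ε * (1 - k / K)) W (stairPt X ε K (k + 1)) ≤ W * (9 / 4 + 1 / 16) := by
    linarith
  have h₁₁ := mul_le_mul_of_nonneg_left h₁₀ hε.le
  have h₁₂ : 0 < ε * W := by positivity
  linarith

lemma stairSet_pos (hε : 0 < ε) (hX : 0 < X) (hK : 0 < K) :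
    ∀ p ∈ stairSet X ε K N, 0 < p.1 ∧ 0 < p.2 := by
  rintro p (rfl | ⟨j, -, rfl⟩)
  · exact ⟨hX, by simp only [stairTop]; positivity⟩
  · exact ⟨by simp only [stairPt]; positivity, by simp only [stairPt]; positivity⟩

/-- The top stays the left endpoint while the right one moves from point k to point k + 1; `i`
counts the points still to come. -/
theorem le_of_chordRoutine_stair {comb : ℝ≥0∞ → ℝ × ℝ}
    (hcomb : ∀ lam, comb lam ∈ stairSet X ε K N ∧
      IsMinOn (combObj lam) (stairSet X ε K N) (comb lam))
    (hε : 0 < ε) (hε' : ε ≤ 1 / 8) (hX : 0 < X) (hN : 4 * (N : ℝ) ≤ K)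
    (hK : 8 ≤ K) (hsep : ∀ k < N, 4 * ε * X ≤ (K ^ k)⁻¹) (i : ℕ) :
    ∀ (k : ℕ) (s : ℝ × ℝ) (Q : Set (ℝ × ℝ)) (n : ℕ), k + i = N →
      IsFrame (stairSet X ε K N) (stairTop X ε) (stairPt X ε K k) s →
      ChordRoutine comb ε (stairTop X ε) (stairPt X ε K k) s Q n → i ≤ n := by
  have hK₀ : 0 < K := by linarith
  have hA := stairSet_pos (N := N) hε hX hK₀
  induction i with
  | zero => intros; omega
  | succ i ih =>
    intro k s Q n hki hf hr
    have hk : k < N := by omega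
    have hlt := scaled_stairPt_lt hε hε' hX hN hK hk (hsep k hk)
    have hkK : (k : ℝ) / K < 1 := by
      have : (k : ℝ) + 1 ≤ N := by exact_mod_cast hk
      rw [div_lt_one hK₀]; linarith
    have hx : (stairTop X ε).1 < (stairPt X ε K k).1 := by
      have : 0 < (K ^ k)⁻¹ := by positivity
      simp only [stairTop, stairPt]; linarith
    have hy : (stairPt X ε K k).2 < (stairTop X ε).2 := by
      simp only [stairTop, stairPt]; nlinarith
    have hq : comb (absSlope (stairTop X ε) (stairPt X ε K k)) = stairPt X ε K (k + 1) := by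
      obtain ⟨h₁, h₂⟩ := hcomb (absSlope (stairTop X ε) (stairPt X ε K k))
      refine eq_stairPt_succ hε hN hK hk h₁ ?_
      rw [lineHt_le_iff_combObj hx hy]
      exact isMinOn_iff.1 h₂ _ (stairPt_mem (by omega))
    have hqmem : stairPt X ε K (k + 1) ∈ stairSet X ε K N := stairPt_mem (by omega)
    have e : ∀ w, lineHt (stairTop X ε) (stairPt X ε K k) w =
        linObj (4 * ε * (1 - k / K)) ((K ^ k)⁻¹) w -
          linObj (4 * ε * (1 - k / K)) ((K ^ k)⁻¹) (stairTop X ε) := fun w => by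
      rw [lineHt_eq_linObj]
      congr 2 <;> simp only [stairTop, stairPt] <;> ring
    have ha : 0 ≤ 4 * ε * (1 - k / K) := mul_nonneg (by positivity) (by linarith)
    have hc : 0 < (K ^ k)⁻¹ := by positivity
    have hr' : linObj (4 * ε * (1 - k / K)) ((K ^ k)⁻¹) (stairTop X ε) ≤
        linObj (4 * ε * (1 - k / K)) ((K ^ k)⁻¹) (stairPt X ε K k) := by
      have h₁ := e (stairPt X ε K k)
      have h₂ : lineHt (stairTop X ε) (stairPt X ε K k) (stairPt X ε K k) = 0 := by
        simp only [lineHt]; ring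
      linarith
    have hqs : ε < ratioDistSeg (stairPt X ε K (k + 1)) (stairTop X ε) (stairPt X ε K k) :=
      lt_ratioDistSeg (hA _ hqmem).1 (hA _ hqmem).2 ha hc le_rfl hr' hlt
    -- The apex has objective at most that of the next point, so it is uncovered too.
    have hss : ε < ratioDistSeg s (stairTop X ε) (stairPt X ε K k) := by
      refine lt_ratioDistSeg ((hA _ hf.left_mem).1.trans_le hf.left_x)
        ((hA _ hf.right_mem).2.trans_le hf.right_y) ha hc le_rfl hr' (lt_of_le_of_lt ?_ hlt)
      have h₁ := hf.apex_le hqmem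
      rw [e, e] at h₁
      exact mul_le_mul_of_nonneg_left (by linarith) (by linarith)
    rcases hr.inversion with h | h | ⟨sl, Ql, nl, h₁, h₂, h₃, h₄⟩
    · exact absurd hss h.not_gt
    · rw [hq] at h
      exact absurd hqs h.not_gt
    · rw [hq] at h₂ h₃
      have hmin := (hcomb (absSlope (stairTop X ε) (stairPt X ε K k))).2
      rw [hq] at hmin
      obtain ⟨α, β, γ, h⟩ := hf.exists_isSplit hε.le hA hss hqmem hmin hqs
      rw [h.eq_cutPt h₁ h₂] at h₃
      have := ih (k + 1) _ Ql nl (by omega) (h.isFrame_left hf) h₃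
      omega

theorem le_chordCalls_stair {comb : ℝ≥0∞ → ℝ × ℝ}
    (hcomb : ∀ lam, comb lam ∈ stairSet X ε K N ∧
      IsMinOn (combObj lam) (stairSet X ε K N) (comb lam))
    (hε : 0 < ε) (hε' : ε ≤ 1 / 8) (hX : 0 < X) (hN : 4 * (N : ℝ) ≤ K)
    (hK : 8 ≤ K) (hsep : ∀ k < N, 4 * ε * X ≤ (K ^ k)⁻¹) :
    ((N + 2 : ℕ) : ℕ∞) ≤ chordCalls comb ε := by
  have hK₀ : 0 < K := by linarith
  obtain ⟨ha, ha'⟩ := hcomb ∞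
  obtain ⟨hb, hb'⟩ := hcomb 0
  have htop : comb ∞ = stairTop X ε := by
    rcases ha with h | ⟨j, -, h⟩
    · exact h
    · have h₁ := isMinOn_iff.1 ha' _ stairTop_mem
      have h₂ : 0 < (K ^ j)⁻¹ := by positivity
      rw [combObj_top, combObj_top, ← h] at h₁
      simp only [stairTop, stairPt] at h₁
      linarith
  have hbot : comb 0 = stairPt X ε K 0 := by
    have h₁ := isMinOn_iff.1 hb' _ (stairPt_mem (Nat.zero_le N))
    rw [combObj_zero, combObj_zero] at h₁
    rcases hb with h | ⟨j, -, h⟩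
    · rw [h] at h₁
      simp only [stairTop, stairPt, Nat.cast_zero, zero_div, mul_zero] at h₁
      linarith
    · rcases Nat.eq_zero_or_pos j with rfl | hj
      · exact h.symm
      · rw [← h] at h₁
        have h₂ : 0 < 4 * ε * ((j : ℝ) / K) := by positivity
        simp only [stairPt, Nat.cast_zero, zero_div, mul_zero] at h₁
        linarith
  have hf := isFrame_initial ha hb ha' hb'
  refine le_iInf₂ fun n hn => ?_
  obtain ⟨Q, k, hr, rfl⟩ := hn
  rw [htop, hbot] at hr hf
  have := le_of_chordRoutine_stair hcomb hε hε' hX hN hK hsep N 0 _ Q k (zero_add N) hf hr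
  exact_mod_cast (by omega : N + 2 ≤ k + 2)

/-- The stair points differ in height by at most 4εN/K ≤ ε, so the last, which is the leftmost of
them, covers the others. -/
lemma opt_stairSet_le (hε : 0 < ε) (hX : 0 < X) (hN : 4 * (N : ℝ) ≤ K) (hK : 8 ≤ K) :
    opt ε (stairSet X ε K N) ≤ 2 := by
  have hK₀ : 0 < K := by linarith
  have hcp : IsEpsCP ε (stairSet X ε K N) {stairTop X ε, stairPt X ε K N} := by
    constructor
    · rintro p (rfl | rfl)
      · exact stairTop_mem
      · exact stairPt_mem le_rfl
    · rintro p (rfl | ⟨j, hj, rfl⟩)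
      · refine ⟨stairTop X ε, subset_convexHull ℝ _ (Set.mem_insert _ _), ?_, ?_⟩ <;>
          simp only [stairTop] <;> nlinarith
      · refine ⟨stairPt X ε K N, subset_convexHull ℝ _ (Set.mem_insert_of_mem _ rfl), ?_, ?_⟩
        · have h₁ : (K ^ N)⁻¹ ≤ (K ^ j)⁻¹ :=
            inv_anti₀ (by positivity) (pow_le_pow_right₀ (by linarith) hj)
          have h₂ : 0 < (K ^ j)⁻¹ := by positivity
          simp only [stairPt]; nlinarith
        · have h₁ : (N : ℝ) / K ≤ 1 / 4 := by rw [div_le_iff₀ hK₀]; linarith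
          have h₂ : 0 ≤ ε * ((j : ℝ) / K) := by positivity
          simp only [stairPt]; nlinarith
  exact (iInf₂_le _ hcp).trans ((Set.encard_insert_le _ _).trans (by
    rw [Set.encard_singleton, one_add_one_eq_two]))

lemma isInstance_stairSet {m : ℝ} (hm : 1 ≤ m) (hε : 0 < ε) (hε' : ε ≤ 1 / 8)
    (hN : 4 * (N : ℝ) ≤ K) (hK : 8 ≤ K) : IsInstance m (stairSet (2 ^ (-m)) ε K N) := by
  have hK₀ : 0 < K := by linarith
  have h₁ : (2 : ℝ) ≤ 2 ^ m := by
    simpa using Real.rpow_le_rpow_of_exponent_le (by norm_num : (1 : ℝ) ≤ 2) hm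
  have h₂ : (2 : ℝ) ^ (-m) ≤ 1 / 2 := by
    rw [Real.rpow_neg (by norm_num), one_div]
    exact inv_anti₀ (by norm_num) h₁
  refine ⟨⟨_, stairTop_mem⟩, ?_, fun lam => ?_⟩
  · rintro p (rfl | ⟨j, hj, rfl⟩)
    · simp only [stairTop, Set.mem_Icc]
      refine ⟨⟨?_, ?_⟩, ?_, ?_⟩ <;> linarith
    · have h₃ : 0 < (K ^ j)⁻¹ := by positivity
      have h₄ : (K ^ j)⁻¹ ≤ 1 := inv_le_one_of_one_le₀ (one_le_pow₀ (by linarith))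
      have h₅ : 0 ≤ (j : ℝ) / K := by positivity
      have h₆ : (j : ℝ) / K ≤ 1 := by
        have : (j : ℝ) ≤ N := by exact_mod_cast hj
        rw [div_le_one hK₀]; linarith
      simp only [stairPt, Set.mem_Icc]
      refine ⟨⟨?_, ?_⟩, ?_, ?_⟩ <;> nlinarith
  · obtain ⟨q, hq, h⟩ := Set.exists_min_image _ (combObj lam) finite_stairSet
      ⟨_, stairTop_mem (X := 2 ^ (-m)) (ε := ε) (K := K) (N := N)⟩
    exact ⟨q, hq, isMinOn_iff.2 h⟩

/-- The number of steps of the staircase that fits into the box. -/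
lemma exists_stair_length {m : ℝ} (hm : 1 ≤ m) (hε : 0 < ε) (hε' : ε < 1 / 16) :
    ∃ (N : ℕ) (K : ℝ), 8 ≤ K ∧ 4 * (N : ℝ) ≤ K ∧ chordRate m ε / 8 ≤ N ∧
      ∀ k < N, 4 * ε * (2 : ℝ) ^ (-m) ≤ (K ^ k)⁻¹ := by
  set ℓ := Real.logb 2 (1 / ε) with hℓ
  have hℓ₄ : 4 < ℓ := by
    rw [hℓ, Real.lt_logb_iff_rpow_lt (by norm_num) (by positivity), lt_div_iff₀ hε]
    norm_num; linarith
  set L := m + ℓ with hL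
  have hL₅ : 5 < L := by linarith
  set Λ := Real.logb 2 m + Real.logb 2 ℓ with hΛ
  -- This is (m - 1)(ℓ - 1) ≥ 0; it compares log L with log m + log ℓ.
  have hmℓ : L - 1 ≤ m * ℓ := by nlinarith
  have hΛ' : Λ = Real.logb 2 (m * ℓ) := (Real.logb_mul (by linarith) (by linarith)).symm
  have hmℓ₀ : 0 < m * ℓ := by linarith
  have hΛ₁ : 1 ≤ Λ := by
    rw [hΛ', Real.le_logb_iff_rpow_le (by norm_num) hmℓ₀, Real.rpow_one]
    linarith
  have hΛ₀ : 0 < Λ := by linarith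
  have hrate : chordRate m ε = L / Λ := rfl
  have hrate₀ : 0 ≤ L / Λ := by positivity
  have hrateL : L / Λ ≤ L := div_le_self (by linarith) hΛ₁
  have hfloor : (⌊L / Λ / 8⌋₊ : ℝ) ≤ L / Λ / 8 := Nat.floor_le (by positivity)
  have hfloor' := Nat.lt_floor_add_one (L / Λ / 8)
  -- K = 4N + 4, so that K ≥ 8 already for N = 1.
  refine ⟨⌊L / Λ / 8⌋₊ + 1, 4 * ((⌊L / Λ / 8⌋₊ + 1 : ℕ) : ℝ) + 4, ?_, ?_, ?_, fun k hk => ?_⟩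
  · push_cast
    have : (0 : ℝ) ≤ ⌊L / Λ / 8⌋₊ := Nat.cast_nonneg _
    linarith
  · linarith
  · rw [hrate]; push_cast; exact hfloor'.le
  · set K : ℝ := 4 * ((⌊L / Λ / 8⌋₊ + 1 : ℕ) : ℝ) + 4 with hKdef
    have hK₁ : 1 < K := by
      rw [hKdef]; push_cast
      have : (0 : ℝ) ≤ ⌊L / Λ / 8⌋₊ := Nat.cast_nonneg _
      linarith
    have hK₀ : 0 < K := by linarith
    have hKle : K ≤ (m * ℓ) ^ 2 := by
      have : K ≤ L / 2 + 8 := by rw [hKdef]; push_cast; linarith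
      nlinarith
    have hlogK : Real.logb 2 K ≤ 2 * Λ := by
      have := Real.logb_le_logb_of_le (b := 2) (by norm_num) hK₀ hKle
      rwa [Real.logb_pow, ← hΛ'] at this
    have hk' : (k : ℝ) ≤ L / Λ / 8 := by
      have : (k : ℝ) ≤ ⌊L / Λ / 8⌋₊ := by exact_mod_cast Nat.lt_succ_iff.1 hk
      linarith
    -- The separation amounts to `k * logb 2 K ≤ L - 2`, and L/4 ≤ L - 2 because L > 5.
    have hkK : (k : ℝ) * Real.logb 2 K ≤ L / 4 := by
      calc (k : ℝ) * Real.logb 2 K ≤ L / Λ / 8 * (2 * Λ) :=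
            mul_le_mul hk' hlogK (Real.logb_nonneg (by norm_num) hK₁.le) (by positivity)
        _ = L / 4 := by field_simp; ring
    have hpos : 0 < 4 * ε * (2 : ℝ) ^ (-m) := by positivity
    rw [← Real.logb_le_logb (by norm_num : (1 : ℝ) < 2) hpos (by positivity), Real.logb_inv,
      Real.logb_pow, Real.logb_mul (by positivity) (by positivity),
      Real.logb_mul (by norm_num) hε.ne', Real.logb_rpow (by norm_num) (by norm_num)]
    have e₁ : ℓ = -Real.logb 2 ε := by rw [hℓ, one_div, Real.logb_inv]
    have e₂ : Real.logb 2 4 = 2 := by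
      rw [show (4 : ℝ) = 2 ^ (2 : ℕ) by norm_num, Real.logb_pow,
        Real.logb_self_eq_one (by norm_num)]
      norm_num
    linarith

theorem le_worstCaseRatio {Comb : Set (ℝ × ℝ) → ℝ≥0∞ → ℝ × ℝ} (hComb : IsExactComb Comb)
    {m : ℝ} (hm : 1 ≤ m) (hε : 0 < ε) (hε' : ε < 1 / 16) :
    ENNReal.ofReal (1 / 16 * chordRate m ε) ≤ worstCaseRatio Comb m ε := by
  obtain ⟨N, K, hK, hN, hrate, hsep⟩ := exists_stair_length hm hε hε'
  have hX : (0 : ℝ) < 2 ^ (-m) := by positivity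
  have hε₈ : ε ≤ 1 / 8 := by linarith
  have hA := isInstance_stairSet hm hε hε₈ hN hK
  refine le_trans ?_ (le_iSup₂ (f := fun (A : Set (ℝ × ℝ))
    (_ : A ∈ {A : Set (ℝ × ℝ) | IsInstance m A}) =>
      (chordCalls (Comb A) ε : ℝ≥0∞) / (opt ε A : ℝ≥0∞)) (stairSet (2 ^ (-m)) ε K N) hA)
  have hcalls : ((N + 2 : ℕ) : ℝ≥0∞) ≤ chordCalls (Comb (stairSet (2 ^ (-m)) ε K N)) ε := by
    have h := le_chordCalls_stair (fun lam => hComb _ lam (hA.exists_min lam)) hε hε₈ hX hN hK hsep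
    exact_mod_cast ENat.toENNReal_le.2 h
  have hopt : (opt ε (stairSet (2 ^ (-m)) ε K N) : ℝ≥0∞) ≤ 2 := by
    exact_mod_cast ENat.toENNReal_le.2 (opt_stairSet_le hε hX hN hK)
  refine le_trans ?_ (ENNReal.div_le_div hcalls hopt)
  rw [ENNReal.le_div_iff_mul_le (Or.inl (by norm_num)) (Or.inl (by norm_num)),
    ← ENNReal.ofReal_natCast, ← ENNReal.ofReal_ofNat 2, ← ENNReal.ofReal_mul' (by norm_num)]
  refine ENNReal.ofReal_le_ofReal ?_
  push_cast
  linarith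

end ChordAlg

theorem theorem1 :
    ∃ c C ε₀ : ℝ, 0 < c ∧ 0 < C ∧ 0 < ε₀ ∧ ε₀ ≤ 1 / 2 ∧
      ∀ Comb : Set (ℝ × ℝ) → ℝ≥0∞ → ℝ × ℝ, ChordAlg.IsExactComb Comb →
        ∀ m ε : ℝ, 1 ≤ m → 0 < ε →
          (ε < 1 / 2 →
            ChordAlg.worstCaseRatio Comb m ε ≤ ENNReal.ofReal (C * ChordAlg.chordRate m ε)) ∧
          (ε < ε₀ →
            ENNReal.ofReal (c * ChordAlg.chordRate m ε) ≤ ChordAlg.worstCaseRatio Comb m ε) :=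
  ⟨1 / 16, 1484, 1 / 16, by norm_num, by norm_num, by norm_num, by norm_num,
    fun _ hComb _ _ hm hε => ⟨ChordAlg.worstCaseRatio_le hComb hm hε,
      ChordAlg.le_worstCaseRatio hComb hm hε⟩⟩
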